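/- **Notation.** $S_\infty$ is the group of bijections of $\{1,2,\dots\}$ fixing all but finitely many elements, $S_{n+1}\subset S_\infty$ the subgroup fixing all $i>n+1$, $s_i=t_{i,i+1}$ where $t_{ab}$ is the transposition of $a$ and $b$, and $\ell(u)$ the number of inversions of $u$. *Double Schubert polynomials.* $S_\infty$ acts on polynomials by $u(x_j)=x_{u(j)}$, fixing all $y_j,z_j$. Put $\partial^{s_i}(P)=\dfrac{P-s_i(P)}{x_i-x_{i+1}}$ and $\partial^u=\partial^{s_{i_1}}\cdots\partial^{s_{i_l}}$ for a reduced (that is, shortest) word $u=s_{i_1}\cdots s_{i_l}$. For $n>0$ let $w_0(n)$ be the longest element of $S_{n+1}$ and $\mathfrak S_{w_0(n)}(x;y)=\prod_{i+j\le n+1}(x_i-y_j)$ (product over $i,j\ge1$); for $u\in S_{n+1}$ let $\mathfrak S_u(x;y)=\partial^{u^{-1}w_0(n)}(\mathfrak S_{w_0(n)}(x;y))$, which depends neither on $n$ nor on the reduced word. *Dominant approximation.* Let $\mathfrak c_i(v)=\#\{j>i: v(i)>v(j)\}$. Call $v$ dominant if $\mathfrak c_1(v)\ge\mathfrak c_2(v)\ge\cdots$.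 If $v$ is dominant, $\mu_v=v$; otherwise $\mu_v=\mu_{vs_i}$, where $i$ is the maximal index with $\mathfrak c_i(v)<\mathfrak c_{i+1}(v)$ (this recursion terminates). Let $\lambda(v)$ be the partition with parts $\lambda_i(v)=\#\{j:\mathfrak c_j(\mu_v)\ge i\}$. *Coefficients.* Write $u\xrightarrow{k}u'$ if there are $0\le p\le k$ and transpositions $t_{a_1b_1},\dots,t_{a_pb_p}$ with $a_i\le k<b_i$, with $a_1,\dots,a_p$ distinct, with $\ell(ut_{a_1b_1}\cdots t_{a_ib_i})=\ell(u)+i$ for all $i\le p$, and with $u'=ut_{a_1b_1}\cdots t_{a_pb_p}$; in that case let $P_k(u,u')=\{u(i): i\le k,\ u(i)=u'(i)\}$. For a partition $\lambda=(\lambda_1,\dots,\lambda_m)$ with $m$ nonzero parts let $\mathrm{Path}_\lambda(u,w)$ be the set of sequences $u=u_0\xrightarrow{\lambda_1}u_1\xrightarrow{\lambda_2}\cdots\xrightarrow{\lambda_m}u_m=w$ and $$d_{u,\lambda}^w(y;z)=\sum_{(u_0,\dots,u_m)\in\mathrm{Path}_\lambda(u,w)}\ \prod_{j=1}^m\ \prod_{q\in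 P_{\lambda_j}(u_{j-1},u_j)}(y_q-z_j).$$ Let $e_{uv}^w(y;z)=d_{u,\lambda(v)}^{wv^{-1}\mu_v}(y;z)$ if $\ell(wv^{-1}\mu_v)=\ell(w)+\ell(v^{-1}\mu_v)$, and $e_{uv}^w(y;z)=0$ otherwise. **Theorem.** Let $u,v\in S_\infty$. 1. Suppose that $v^{-1}\mu_v=s_{i_1}\cdots s_{i_m}$ for some (possibly empty, not necessarily reduced) word with $\ell(us_{i_j})>\ell(u)$ for all $j$. Then all sets $\mathrm{Path}_{\lambda(v)}(u,w)$ are finite, $e_{uv}^w(y;z)\neq0$ for only finitely many $w$, and $$\mathfrak S_u(x;y)\,\mathfrak S_v(x;z)=\sum_{w\in S_\infty}e_{uv}^w(y;z)\,\mathfrak S_w(x;y).$$ 2. The hypothesis of (1) holds whenever $u$ and $v$ have separated descents, that is, whenever there is $p>0$ with $\ell(us_i)>\ell(u)$ for all $i<p$ and $\ell(vs_i)>\ell(v)$ for all $i>p$. 3. The hypothesis of (1) holds for every $u$ whenever $v$ is dominant. -/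

import Mathlib

/-!
Conventions.  Positive integers are relabelled as natural numbers by `i ↦ i - 1`: the Lean
index `i` stands for the `(i + 1)`-st position, value, variable `x`, `y`, `z`, adjacent
transposition, code entry, part of a partition.  A cardinality or a length (such as `k` in
`KStep k`) is not shifted, so "`a` is one of the first `k` positions" reads `a < k`.
-/

namespace DoubleSchubert

/-! ### The infinite symmetric group -/

/-- The infinite symmetric group: bijections fixing all but finitely many elements. -/
def SInf : Subgroup (Equiv.Perm ℕ) where
  carrier := {f | {i | f i ≠ i}.Finite}
  one_mem' := by simp
  mul_mem' := by
    intro f g hf hg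
    refine (hf.union hg).subset ?_
    intro i hi
    by_contra h
    simp only [Set.mem_union, Set.mem_ofPred_eq, not_or, not_not] at h
    exact hi (by rw [Equiv.Perm.mul_apply, h.2, h.1])
  inv_mem' := by
    intro f hf
    refine Set.Finite.subset hf ?_
    intro i hi h
    exact hi (by rw [Equiv.Perm.inv_eq_iff_eq, h])

/-- The transposition `t_{ab}` (the identity when `a = b`). -/
def transp (a b : ℕ) : SInf :=
  ⟨Equiv.swap a b, by
    refine Set.Finite.subset (Set.toFinite {a, b}) ?_
    intro i hi
    by_contra h
    simp only [Set.mem_insert_iff, Set.mem_singleton_iff, not_or] at h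
    exact hi (Equiv.swap_apply_of_ne_of_ne h.1 h.2)⟩

/-- The adjacent transposition `s_i`. -/
def simpleRefl (i : ℕ) : SInf := transp i (i + 1)

/-- The length: the number of inversions. -/
noncomputable def len (u : SInf) : ℕ :=
  {p : ℕ × ℕ | p.1 < p.2 ∧ u.1 p.2 < u.1 p.1}.ncard

/-- The product `s_{i_1} ⋯ s_{i_m}` of a word, given by its list of indices. -/
def wordProd (ω : List ℕ) : SInf := (ω.map simpleRefl).prod

/-- A reduced word for `u`: a word for `u` that is as short as possible. -/
def IsReducedWord (u : SInf) (ω : List ℕ) : Prop :=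
  wordProd ω = u ∧ ∀ ω' : List ℕ, wordProd ω' = u → ω.length ≤ ω'.length

theorem swap_mem_closure (a d : ℕ) : Equiv.swap a (a + d + 1) ∈
    Subgroup.closure (Set.range fun i : ℕ => Equiv.swap i (i + 1)) := by
  induction d with
  | zero => exact Subgroup.subset_closure ⟨a, rfl⟩
  | succ d ih =>
    have h1 : Equiv.swap (a + d + 1) (a + d + 1 + 1) ∈
        Subgroup.closure (Set.range fun i : ℕ => Equiv.swap i (i + 1)) :=
      Subgroup.subset_closure ⟨a + d + 1, rfl⟩
    have h2 := Equiv.swap_mul_swap_mul_swap (x := a) (y := a + d + 1) (z := a + d + 1 + 1)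
      (by omega) (by omega)
    have h3 : Equiv.swap a (a + (d + 1) + 1) =
        Equiv.swap (a + d + 1) (a + d + 1 + 1) * Equiv.swap a (a + d + 1) *
          Equiv.swap (a + d + 1) (a + d + 1 + 1) := by
      rw [Equiv.swap_comm a (a + (d + 1) + 1)]
      exact h2.symm
    rw [h3]
    exact Subgroup.mul_mem _ (Subgroup.mul_mem _ h1 ih) h1

theorem exists_word (u : SInf) : ∃ ω : List ℕ, wordProd ω = u := by
  have hu : u.1 ∈ Subgroup.closure (Set.range fun i : ℕ => Equiv.swap i (i + 1)) := by
    have h1 : u.1 ∈ Subgroup.closure {σ : Equiv.Perm ℕ | σ.IsSwap} := by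
      rw [_root_.mem_closure_isSwap']
      refine Set.Finite.subset u.2 ?_
      intro i hi
      simpa using hi
    refine (Subgroup.closure_le _).2 ?_ h1
    rintro σ ⟨a, b, hab, rfl⟩
    rcases lt_or_gt_of_ne hab with h | h
    · obtain ⟨d, rfl⟩ := Nat.exists_eq_add_of_lt h
      exact swap_mem_closure a d
    · obtain ⟨d, rfl⟩ := Nat.exists_eq_add_of_lt h
      rw [Equiv.swap_comm]
      exact swap_mem_closure b d
  have key : ∀ g ∈ Subgroup.closure (Set.range fun i : ℕ => Equiv.swap i (i + 1)),
      ∃ ω : List ℕ, (wordProd ω).1 = g := by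
    intro g hg
    induction hg using Subgroup.closure_induction with
    | mem x hx =>
      obtain ⟨i, rfl⟩ := hx
      exact ⟨[i], by simp [wordProd, simpleRefl, transp]⟩
    | one => exact ⟨[], by simp [wordProd]⟩
    | mul x y _ _ hx hy =>
      obtain ⟨a, rfl⟩ := hx
      obtain ⟨b, rfl⟩ := hy
      exact ⟨a ++ b, by simp [wordProd]⟩
    | inv x _ hx =>
      obtain ⟨a, rfl⟩ := hx
      refine ⟨a.reverse, ?_⟩
      have hs : ∀ i, (simpleRefl i)⁻¹ = simpleRefl i := fun i => Subtype.ext (by simp [simpleRefl, transp])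
      have : wordProd a.reverse = (wordProd a)⁻¹ := by
        unfold wordProd
        rw [List.prod_inv_reverse, List.map_reverse, List.map_map]
        congr 3
      rw [this]
      rfl
  obtain ⟨ω, hω⟩ := key u.1 hu
  exact ⟨ω, Subtype.ext hω⟩

theorem exists_isReducedWord (u : SInf) : ∃ ω : List ℕ, IsReducedWord u ω := by
  classical
  have h : ∃ n, ∃ ω : List ℕ, wordProd ω = u ∧ ω.length = n := by
    obtain ⟨ω, hω⟩ := exists_word u
    exact ⟨_, ω, hω, rfl⟩
  obtain ⟨ω, hω, hl⟩ := Nat.find_spec h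
  exact ⟨ω, hω, fun ω' hω' => hl ▸ Nat.find_min' h ⟨ω', hω', rfl⟩⟩

/-- A chosen reduced word. -/
noncomputable def reducedWord (u : SInf) : List ℕ := (exists_isReducedWord u).choose

theorem reducedWord_spec (u : SInf) : IsReducedWord u (reducedWord u) :=
  (exists_isReducedWord u).choose_spec

/-- `u ∈ S_{n+1}` (in the relabelling, `u` permutes `{0, …, n}`). -/
def MemS (n : ℕ) (u : SInf) : Prop := ∀ i, n < i → u.1 i = i

theorem exists_memS (u : SInf) : ∃ n, 0 < n ∧ MemS n u := by
  obtain ⟨N, hN⟩ := Set.Finite.bddAbove u.2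
  refine ⟨N + 1, by omega, fun i hi => ?_⟩
  by_contra h
  have : i ≤ N := hN h
  omega

/-- The longest element `w_0(n)` of `S_{n+1}`. -/
def w0 (n : ℕ) : SInf :=
  ⟨Function.Involutive.toPerm (fun i => if i ≤ n then n - i else i) (by
      intro i
      by_cases h : i ≤ n
      · simp only [h, if_true]
        rw [if_pos (by omega)]
        omega
      · simp [h]), by
    refine Set.Finite.subset (Set.finite_Iic n) ?_
    intro i hi
    by_contra h
    simp only [Set.mem_Iic] at h
    exact hi (if_neg h)⟩

/-! ### Double Schubert polynomials -/

section Schubert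

variable {R : Type*} [CommRing R]

open MvPolynomial

/-- The action on `R[x]` by `u(x_j) = x_{u(j)}`, fixing the coefficients. -/
noncomputable def act (u : SInf) (P : MvPolynomial ℕ R) : MvPolynomial ℕ R := rename u.1 P

theorem X_sub_X_dvd (i : ℕ) (P : MvPolynomial ℕ R) :
    (X i - X (i + 1) : MvPolynomial ℕ R) ∣ P - act (simpleRefl i) P := by
  rw [← Ideal.mem_span_singleton, ← Ideal.Quotient.eq]
  set I : Ideal (MvPolynomial ℕ R) := Ideal.span {X i - X (i + 1)} with hI
  have hx : Ideal.Quotient.mk I (X i) = Ideal.Quotient.mk I (X (i + 1)) :=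
    Ideal.Quotient.eq.2 (Ideal.mem_span_singleton_self _)
  have h : Ideal.Quotient.mkₐ R I = (Ideal.Quotient.mkₐ R I).comp (rename (simpleRefl i).1) := by
    apply MvPolynomial.algHom_ext
    intro j
    rw [AlgHom.comp_apply, rename_X]
    simp only [Ideal.Quotient.mkₐ_eq_mk, simpleRefl, transp]
    by_cases h1 : j = i
    · subst h1; rw [Equiv.swap_apply_left, hx]
    · by_cases h2 : j = i + 1
      · subst h2; rw [Equiv.swap_apply_right, hx]
      · rw [Equiv.swap_apply_of_ne_of_ne h1 h2]
  exact DFunLike.congr_fun h P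

/-- The divided difference `∂^{s_i}(P) = (P - s_i(P)) / (x_i - x_{i+1})`.  The quotient is unique
because `x_i - x_{i+1}` is not a zero divisor in `R[x]`. -/
noncomputable def ddiff (i : ℕ) (P : MvPolynomial ℕ R) : MvPolynomial ℕ R :=
  (X_sub_X_dvd i P).choose

theorem ddiff_spec (i : ℕ) (P : MvPolynomial ℕ R) :
    P - act (simpleRefl i) P = (X i - X (i + 1)) * ddiff i P :=
  (X_sub_X_dvd i P).choose_spec

/-- `∂^u = ∂^{s_{i_1}} ∘ ⋯ ∘ ∂^{s_{i_l}}` for a reduced word `s_{i_1} ⋯ s_{i_l}` of `u`. -/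
noncomputable def ddiffPerm (u : SInf) (P : MvPolynomial ℕ R) : MvPolynomial ℕ R :=
  (reducedWord u).foldr ddiff P

/-- `𝔖_{w_0(n)}(x;a) = ∏_{i+j ≤ n+1} (x_i - a_j)`, the product being over positive `i`, `j`
(after relabelling, `i + j < n`). -/
noncomputable def schubTop (a : ℕ → R) (n : ℕ) : MvPolynomial ℕ R :=
  ∏ p ∈ (Finset.range n ×ˢ Finset.range n).filter (fun p => p.1 + p.2 < n),
    (X p.1 - C (a p.2))

open Classical in
/-- The double Schubert polynomial `𝔖_u(x;a) = ∂^{u⁻¹ w_0(n)} 𝔖_{w_0(n)}(x;a)`, where `n > 0` is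
the least one with `u ∈ S_{n+1}` (the result is the same for every such `n`), as a polynomial in
`x` with coefficients in a ring that contains the secondary variables `a`. -/
noncomputable def schub (a : ℕ → R) (u : SInf) : MvPolynomial ℕ R :=
  ddiffPerm (u⁻¹ * w0 (Nat.find (exists_memS u))) (schubTop a (Nat.find (exists_memS u)))

end Schubert

/-! ### Code and dominant approximation -/

/-- The code: `c_i(v) = #{j > i | v(i) > v(j)}`. -/
noncomputable def code (v : SInf) (i : ℕ) : ℕ := {j | i < j ∧ v.1 j < v.1 i}.ncard

/-- `v` is dominant: its code is a partition, that is, weakly decreasing. -/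
def IsDominant (v : SInf) : Prop := ∀ i, code v (i + 1) ≤ code v i

/-- `i` is the maximal index with `c_i(v) < c_{i+1}(v)`. -/
def IsLastAscent (v : SInf) (i : ℕ) : Prop := IsGreatest {j | code v j < code v (j + 1)} i

open Classical in
/-- One step of the recursion for the dominant approximation: `v` if `v` is dominant, and `v s_i`
otherwise, with `i` the maximal index such that `c_i(v) < c_{i+1}(v)`. -/
noncomputable def domStep (v : SInf) : SInf :=
  if h : ∃ i, IsLastAscent v i then v * simpleRefl h.choose else v

theorem code_set_finite (v : SInf) (i : ℕ) : {j | i < j ∧ v.1 j < v.1 i}.Finite :=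
  ((Set.finite_Iio (v.1 i)).preimage v.1.injective.injOn).subset fun _ hj => hj.2

theorem lt_of_code_lt (v : SInf) (i : ℕ) (h : code v i < code v (i + 1)) :
    v.1 i < v.1 (i + 1) := by
  by_contra hc
  have hc' : v.1 (i + 1) ≤ v.1 i := not_lt.1 hc
  refine absurd h (not_lt.2 (Set.ncard_le_ncard ?_ (code_set_finite v i)))
  rintro j ⟨h1, h2⟩
  exact ⟨by omega, by omega⟩

theorem code_eq_zero {n : ℕ} {v : SInf} (hv : MemS n v) {i : ℕ} (hi : n < i) : code v i = 0 := by
  unfold code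
  have : {j | i < j ∧ v.1 j < v.1 i} = ∅ := by
    ext j
    simp only [Set.mem_ofPred_eq, Set.mem_empty_iff_false, iff_false, not_and]
    intro hj
    rw [hv i hi, hv j (by omega)]
    omega
  rw [this, Set.ncard_empty]

theorem exists_isLastAscent {v : SInf} (h : ¬ IsDominant v) : ∃ i, IsLastAscent v i := by
  obtain ⟨n, -, hn⟩ := exists_memS v
  unfold IsDominant at h
  push Not at h
  obtain ⟨i, hi⟩ := h
  have hb : BddAbove {j | code v j < code v (j + 1)} := by
    refine ⟨n, fun j hj => ?_⟩
    by_contra hc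
    have : code v (j + 1) = 0 := code_eq_zero hn (by omega)
    simp only [Set.mem_ofPred_eq] at hj
    omega
  exact ⟨_, Nat.sSup_mem ⟨i, hi⟩ hb, fun j hj => le_csSup hb hj⟩

theorem domStep_of_isDominant {v : SInf} (h : IsDominant v) : domStep v = v := by
  unfold domStep
  rw [dif_neg]
  rintro ⟨i, hi, -⟩
  exact absurd (h i) (not_le.2 hi)

theorem domStep_of_isLastAscent {v : SInf} {i : ℕ} (h : IsLastAscent v i) :
    domStep v = v * simpleRefl i := by
  have h' : ∃ i, IsLastAscent v i := ⟨i, h⟩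
  unfold domStep
  rw [dif_pos h', h'.choose_spec.unique h]

theorem domStep_memS {n : ℕ} {v : SInf} (hv : MemS n v) (hd : ¬ IsDominant v) :
    MemS n (domStep v) ∧ ∑ j ∈ Finset.range (n + 1), j * (domStep v).1 j <
      ∑ j ∈ Finset.range (n + 1), j * v.1 j := by
  obtain ⟨i, hi⟩ := exists_isLastAscent hd
  have hlt := lt_of_code_lt v i hi.1
  have hin : i + 1 ≤ n := by
    by_contra hc
    have h0 : code v (i + 1) = 0 := code_eq_zero hv (by omega)
    have := hi.1
    simp only [Set.mem_ofPred_eq] at this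
    omega
  rw [domStep_of_isLastAscent hi]
  have hval : ∀ j, (v * simpleRefl i).1 j = v.1 (Equiv.swap i (i + 1) j) := fun j => rfl
  refine ⟨fun j hj => ?_, ?_⟩
  · rw [hval, Equiv.swap_apply_of_ne_of_ne (by omega) (by omega), hv j hj]
  · have hi1 : i ∈ Finset.range (n + 1) := by simp; omega
    have hi2 : i + 1 ∈ (Finset.range (n + 1)).erase i := by simp; omega
    rw [← Finset.add_sum_erase _ _ hi1, ← Finset.add_sum_erase _ _ hi2,
      ← Finset.add_sum_erase (Finset.range (n + 1)) (fun j => j * v.1 j) hi1,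
      ← Finset.add_sum_erase _ (fun j => j * v.1 j) hi2]
    have hrest : ∑ j ∈ ((Finset.range (n + 1)).erase i).erase (i + 1), j * (v * simpleRefl i).1 j =
        ∑ j ∈ ((Finset.range (n + 1)).erase i).erase (i + 1), j * v.1 j := by
      refine Finset.sum_congr rfl fun j hj => ?_
      simp only [Finset.mem_erase] at hj
      rw [hval, Equiv.swap_apply_of_ne_of_ne hj.2.1 hj.1]
    rw [hrest, hval, hval, Equiv.swap_apply_left, Equiv.swap_apply_right]
    nlinarith

theorem exists_isDominant (v : SInf) : ∃ k : ℕ, IsDominant (domStep^[k] v) := by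
  obtain ⟨n, -, hn⟩ := exists_memS v
  induction hm : ∑ j ∈ Finset.range (n + 1), j * v.1 j using Nat.strong_induction_on
    generalizing v with
  | _ m ih =>
    by_cases hd : IsDominant v
    · exact ⟨0, hd⟩
    · obtain ⟨h1, h2⟩ := domStep_memS hn hd
      obtain ⟨k, hk⟩ := ih _ (hm ▸ h2) (domStep v) h1 rfl
      exact ⟨k + 1, hk⟩

open Classical in
/-- The dominant approximation `μ_v`: iterate the step until a dominant permutation is reached. -/
noncomputable def domApprox (v : SInf) : SInf := domStep^[Nat.find (exists_isDominant v)] v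

theorem domApprox_isDominant (v : SInf) : IsDominant (domApprox v) := by
  classical
  exact Nat.find_spec (exists_isDominant v)

theorem domStep_iterate_eq {v : SInf} (k : ℕ) (hk : IsDominant (domStep^[k] v)) :
    domStep^[k] v = domApprox v := by
  classical
  have hle := Nat.find_min' (exists_isDominant v) hk
  obtain ⟨d, hd⟩ := Nat.exists_eq_add_of_le hle
  have hfix : ∀ d, domStep^[d] (domApprox v) = domApprox v := fun d =>
    Function.iterate_fixed (domStep_of_isDominant (domApprox_isDominant v)) d
  rw [hd, Nat.add_comm, Function.iterate_add_apply]
  exact hfix d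

/-- If `v` is dominant, then `μ_v = v`. -/
theorem domApprox_of_isDominant {v : SInf} (h : IsDominant v) : domApprox v = v :=
  (domStep_iterate_eq 0 h).symm

/-- If `i` is the maximal index with `c_i(v) < c_{i+1}(v)`, then `μ_v = μ_{v s_i}`. -/
theorem domApprox_of_isLastAscent {v : SInf} {i : ℕ} (h : IsLastAscent v i) :
    domApprox v = domApprox (v * simpleRefl i) := by
  obtain ⟨k, hk⟩ := exists_isDominant (v * simpleRefl i)
  rw [← domStep_iterate_eq k hk, ← domStep_of_isLastAscent h, ← Function.iterate_succ_apply]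
  refine (domStep_iterate_eq (k + 1) ?_).symm
  rw [Function.iterate_succ_apply, domStep_of_isLastAscent h]
  exact hk

/-- `λ_i(v) = #{j | c_j(μ_v) ≥ i}` for positive `i` (after relabelling, `c_j(μ_v) > i`). -/
noncomputable def lamPart (v : SInf) (i : ℕ) : ℕ := {j | i < code (domApprox v) j}.ncard

/-- The partition `λ(v)`, as the list of its nonzero parts. -/
noncomputable def lam (v : SInf) : List ℕ :=
  (List.range {i | lamPart v i ≠ 0}.ncard).map (lamPart v)

/-! ### Paths, weights and coefficients -/

/-- The product `t_{a_1 b_1} ⋯ t_{a_p b_p}`. -/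
def transProd (L : List (ℕ × ℕ)) : SInf := (L.map fun p => transp p.1 p.2).prod

/-- The relation `u →_k u'`: there are `0 ≤ p ≤ k` and transpositions `t_{a_1 b_1}, …, t_{a_p b_p}`
with every `a_i` among the first `k` positions and every `b_i` beyond them, with the `a_i` distinct,
with `ℓ(u t_{a_1 b_1} ⋯ t_{a_i b_i}) = ℓ(u) + i` for all `i`, and with
`u' = u t_{a_1 b_1} ⋯ t_{a_p b_p}`. -/
def KStep (k : ℕ) (u u' : SInf) : Prop :=
  ∃ L : List (ℕ × ℕ), L.length ≤ k ∧
    (∀ p ∈ L, p.1 < k ∧ k ≤ p.2) ∧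
    (L.map Prod.fst).Nodup ∧
    (∀ i ≤ L.length, len (u * transProd (L.take i)) = len u + i) ∧
    u' = u * transProd L

/-- `P_k(u,w)`: the set of the values `u(i)` with `i` among the first `k` positions and
`u(i) = w(i)`. -/
def fixedValues (k : ℕ) (u w : SInf) : Finset ℕ :=
  ((Finset.range k).filter fun i => u.1 i = w.1 i).image u.1

/-- The ring `ℤ[y,z]`. -/
abbrev CoeffRing : Type := MvPolynomial (ℕ ⊕ ℕ) ℤ

/-- The variables `y_i`. -/
noncomputable def varY (i : ℕ) : CoeffRing := MvPolynomial.X (Sum.inl i)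

/-- The variables `z_j`. -/
noncomputable def varZ (j : ℕ) : CoeffRing := MvPolynomial.X (Sum.inr j)

/-- `weight_{u,k}^w(y;z_j)`, the product of `y_q - z_j` over `q ∈ P_k(u,w)`. -/
noncomputable def stepWeight (k : ℕ) (u w : SInf) (j : ℕ) : CoeffRing :=
  ∏ q ∈ fixedValues k u w, (varY q - varZ j)

/-- `Path_λ(u,w)`: the sequences `(u_0, …, u_m)`, with `m` the length of `λ`, such that
`u = u_0 →_{λ_1} u_1 →_{λ_2} ⋯ →_{λ_m} u_m = w`. -/
def PathSet (lm : List ℕ) (u w : SInf) : Set (Fin (lm.length + 1) → SInf) :=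
  {P | P 0 = u ∧ P (Fin.last _) = w ∧
    ∀ i : Fin lm.length, KStep (lm.get i) (P i.castSucc) (P i.succ)}

/-- `weight_{P,λ}(y;z)`. -/
noncomputable def pathWeight (lm : List ℕ) (P : Fin (lm.length + 1) → SInf) : CoeffRing :=
  ∏ i : Fin lm.length, stepWeight (lm.get i) (P i.castSucc) (P i.succ) i

/-- `d_{u,λ}^w(y;z)`, the sum of the weights of the paths in `Path_λ(u,w)`. -/
noncomputable def dCoeff (u : SInf) (lm : List ℕ) (w : SInf) : CoeffRing :=
  ∑ᶠ P ∈ PathSet lm u w, pathWeight lm P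

/-- `e_{uv}^w(y;z)`. -/
noncomputable def eCoeff (u v w : SInf) : CoeffRing :=
  if len (w * v⁻¹ * domApprox v) = len w + len (v⁻¹ * domApprox v) then
    dCoeff u (lam v) (w * v⁻¹ * domApprox v)
  else 0

/-- `g` can be written as `s_{i_1} ⋯ s_{i_m}` with `ℓ(u s_{i_j}) > ℓ(u)` for all `j`. -/
def HasAscentWord (u g : SInf) : Prop :=
  ∃ ω : List ℕ, g = wordProd ω ∧ ∀ i ∈ ω, len u < len (u * simpleRefl i)

end DoubleSchubert

open DoubleSchubert

/-!
# Products of double Schubert polynomials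

The product formula is reduced to a Pieri formula for the factorial elementary polynomials
`E_k(z) = ∏_{i ≤ k} (x_i - z)`: for all `u` and `k`,
`E_k(z) 𝔖_u(x;y) = ∑_w ∏_{q ∈ P_k(u,w)} (y_q - z) 𝔖_w(x;y)`, the sum being over all `w` with
`u →_k w` (`pieriAt`).

*From the Pieri formula to the theorem.*  A dominant permutation has
`𝔖_μ(x;z) = ∏_i ∏_{j ≤ c_i(μ)} (x_i - z_j)` (`schub_of_isDominant`), and for `μ = μ_v` this product,
read by columns, is `∏_j E_{λ_j(v)}(z_j)` (`schub_domApprox`).  Hence iterating the Pieri formula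
expands `𝔖_u(x;y) 𝔖_{μ_v}(x;z)` with the coefficients `d` (`pieri_dCoeff`).  The recursion for `μ_v`
goes up in length, so that `𝔖_v = ∂^g 𝔖_{μ_v}` for `g = v⁻¹ μ_v`; if `g` is a product of ascents of
`u`, then `∂^g` is linear over `𝔖_u` (`ddiffPerm_schub_mul`), and applying `∂^g` to the expansion
gives the theorem (`schub_mul_schub`), as `∂^g` maps `𝔖_{wg}` to `𝔖_w` or to zero according to
whether the lengths of `w` and `g` add up.  If `v` is increasing from some position on, the recursion
for `μ_v` uses only the `s_i` to the left of it, whence the statement on separated descents.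

*The Pieri formula.*  It is proved by descent from a longest element `w_0(n)` with `n ≥ k`.  If
`u s_i < u` and `i ≠ k`, then `∂_i` commutes with `E_k` and carries the formula for `u` to the one
for `u s_i` (`PieriAt.mul_simpleRefl`).  If `s_i u < u` and the values `i` and `i + 1` of `u` stand on
different sides of `k`, then comparing both sides with their images under the exchange of `y_i` and
`y_{i+1}` carries the formula for `u` to the one for `s_i u` (`PieriAt.simpleRefl_mul`), because this
exchange acts on double Schubert polynomials through left multiplication by `s_i`
(`schub_sub_map`).  Every element of `S_{n+1}` is reached from `w_0(n)` by such steps.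
On the combinatorial side both steps say that the chains which define `u →_k w` can be multiplied by
`s_i` on the right or left; since each position `a_i` occurs once in a chain, a step that exchanges
the values `i` and `i + 1` is possible at one place only (`KChain.left_of_apply_ne`,
`KChain.left_of_apply_eq`).  For `w_0(n)` itself, the permutations `w` with `w_0(n) →_k w` correspond
to the subsets `A` of `{1, …, k}` and are dominant, with `A` indicating the rows of the staircase
that have gained a cell (`KChain.eq_topPerm`, `schub_topPerm`), so that the formula is the expansion
of `∏_{i ≤ k} ((x_i - y_{n+2-i}) + (y_{n+2-i} - z))` (`pieriAt_w0`).

The operators `∂^u` do not depend on the reduced word by the braid relations and induction on the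
length (`foldr_ddiff_eq`).
-/

namespace DoubleSchubert

/-! ### Length -/

theorem coe_mul_apply (u v : SInf) (j : ℕ) : (u * v).1 j = u.1 (v.1 j) := rfl

theorem coe_one_apply (j : ℕ) : (1 : SInf).1 j = j := rfl

theorem coe_transp_apply (a b j : ℕ) :
    (transp a b).1 j = if j = a then b else if j = b then a else j :=
  Equiv.swap_apply_def a b j

theorem coe_simpleRefl_apply (i j : ℕ) :
    (simpleRefl i).1 j = if j = i then i + 1 else if j = i + 1 then i else j :=
  Equiv.swap_apply_def i (i + 1) j

theorem inv_apply_self' (u : SInf) (j : ℕ) : (u⁻¹).1 (u.1 j) = j := Equiv.symm_apply_apply u.1 j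

theorem apply_inv_self' (u : SInf) (j : ℕ) : u.1 ((u⁻¹).1 j) = j := Equiv.apply_symm_apply u.1 j

theorem SInf.ext_apply {u v : SInf} (h : ∀ j, u.1 j = v.1 j) : u = v :=
  Subtype.ext (Equiv.ext h)

theorem transp_mul_self (a b : ℕ) : transp a b * transp a b = 1 :=
  Subtype.ext (Equiv.swap_mul_self a b)

theorem simpleRefl_mul_self (i : ℕ) : simpleRefl i * simpleRefl i = 1 := transp_mul_self _ _

theorem simpleRefl_apply_apply (i j : ℕ) : (simpleRefl i).1 ((simpleRefl i).1 j) = j := by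
  rw [← coe_mul_apply, simpleRefl_mul_self]
  rfl

theorem mul_simpleRefl_mul_simpleRefl (u : SInf) (i : ℕ) :
    u * simpleRefl i * simpleRefl i = u := by
  rw [mul_assoc, simpleRefl_mul_self, mul_one]

theorem simpleRefl_mul_simpleRefl_mul (u : SInf) (i : ℕ) :
    simpleRefl i * (simpleRefl i * u) = u := by
  rw [← mul_assoc, simpleRefl_mul_self, one_mul]

theorem simpleRefl_inv (i : ℕ) : (simpleRefl i)⁻¹ = simpleRefl i :=
  inv_eq_of_mul_eq_one_left (simpleRefl_mul_self i)

theorem mul_transp_apply (u : SInf) (a b j : ℕ) :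
    (u * transp a b).1 j = if j = a then u.1 b else if j = b then u.1 a else u.1 j := by
  rw [coe_mul_apply, coe_transp_apply]
  split_ifs <;> rfl

theorem mul_simpleRefl_apply (u : SInf) (i j : ℕ) : (u * simpleRefl i).1 j =
    if j = i then u.1 (i + 1) else if j = i + 1 then u.1 i else u.1 j :=
  mul_transp_apply u i (i + 1) j

theorem mul_simpleRefl_apply_self (u : SInf) (i : ℕ) :
    (u * simpleRefl i).1 i = u.1 (i + 1) := by
  rw [mul_simpleRefl_apply, if_pos rfl]

theorem mul_simpleRefl_apply_succ (u : SInf) (i : ℕ) :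
    (u * simpleRefl i).1 (i + 1) = u.1 i := by
  rw [mul_simpleRefl_apply, if_neg (by omega), if_pos rfl]

theorem mul_simpleRefl_apply_of_ne (u : SInf) {i j : ℕ} (h1 : j ≠ i) (h2 : j ≠ i + 1) :
    (u * simpleRefl i).1 j = u.1 j := by
  rw [mul_simpleRefl_apply, if_neg h1, if_neg h2]

theorem simpleRefl_mul_inv (u : SInf) (i : ℕ) : (simpleRefl i * u)⁻¹ = u⁻¹ * simpleRefl i := by
  rw [mul_inv_rev, simpleRefl_inv]

theorem MemS.mono {n m : ℕ} {u : SInf} (hu : MemS n u) (h : n ≤ m) : MemS m u :=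
  fun i hi => hu i (by omega)

theorem MemS.apply_le {n : ℕ} {u : SInf} (hu : MemS n u) {i : ℕ} (hi : i ≤ n) : u.1 i ≤ n := by
  by_contra h
  have h1 := hu (u.1 i) (by omega)
  have h2 := u.1.injective h1
  omega

theorem MemS.mul {n : ℕ} {u v : SInf} (hu : MemS n u) (hv : MemS n v) : MemS n (u * v) :=
  fun i hi => by rw [coe_mul_apply, hv i hi, hu i hi]

theorem MemS.inv {n : ℕ} {u : SInf} (hu : MemS n u) : MemS n u⁻¹ := fun i hi => by
  conv_lhs => rw [← hu i hi]
  exact inv_apply_self' u i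

theorem memS_transp {n a b : ℕ} (ha : a ≤ n) (hb : b ≤ n) : MemS n (transp a b) := fun i hi => by
  rw [coe_transp_apply, if_neg (by omega), if_neg (by omega)]

theorem memS_simpleRefl {n i : ℕ} (h : i + 1 ≤ n) : MemS n (simpleRefl i) :=
  memS_transp (by omega) h

theorem finite_memS (n : ℕ) : {u : SInf | MemS n u}.Finite := by
  have h : (Set.pi Set.univ fun _ : Fin (n + 1) => Set.Iic n).Finite :=
    Set.Finite.pi fun _ => Set.finite_Iic n
  refine Set.Finite.of_finite_image (f := fun u : SInf => fun i : Fin (n + 1) => u.1 i)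
    (h.subset ?_) ?_
  · rintro _ ⟨u, hu, rfl⟩ i -
    exact MemS.apply_le hu (by omega)
  · intro u hu v hv huv
    refine SInf.ext_apply fun j => ?_
    by_cases hj : j ≤ n
    · exact congrFun huv ⟨j, by omega⟩
    · rw [hu j (by omega), hv j (by omega)]

/-- The set of inversions, whose cardinality is the length. -/
def invSet (u : SInf) : Set (ℕ × ℕ) := {p : ℕ × ℕ | p.1 < p.2 ∧ u.1 p.2 < u.1 p.1}

theorem invSet_subset {n : ℕ} {u : SInf} (hu : MemS n u) :
    invSet u ⊆ (Finset.range (n + 1) ×ˢ Finset.range (n + 1) : Finset (ℕ × ℕ)) := by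
  rintro ⟨p, q⟩ ⟨h1, h2⟩
  simp only at h1 h2
  have hq : q ≤ n := by
    by_contra hq
    rw [hu q (by omega)] at h2
    by_cases hp : p ≤ n
    · have := hu.apply_le hp; omega
    · rw [hu p (by omega)] at h2; omega
  simp
  omega

theorem invSet_finite (u : SInf) : (invSet u).Finite := by
  obtain ⟨n, -, hn⟩ := exists_memS u
  exact (Finset.finite_toSet _).subset (invSet_subset hn)

theorem len_le_of_memS {n : ℕ} {u : SInf} (hu : MemS n u) : len u ≤ (n + 1) * (n + 1) := by
  refine (Set.ncard_le_ncard (invSet_subset hu) (Finset.finite_toSet _)).trans ?_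
  rw [Set.ncard_coe_finset]
  simp

theorem len_mul_simpleRefl_of_lt {u : SInf} {i : ℕ} (h : u.1 i < u.1 (i + 1)) :
    len (u * simpleRefl i) = len u + 1 := by
  have key : invSet (u * simpleRefl i) = insert (i, i + 1)
      ((Prod.map (simpleRefl i).1 (simpleRefl i).1) '' invSet u) := by
    ext ⟨p, q⟩
    have hs := simpleRefl_apply_apply i
    have him : (p, q) ∈ (Prod.map (simpleRefl i).1 (simpleRefl i).1) '' invSet u ↔
        ((simpleRefl i).1 p, (simpleRefl i).1 q) ∈ invSet u := by
      constructor
      · rintro ⟨⟨a, b⟩, hab, he⟩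
        simp only [Prod.map_apply, Prod.mk.injEq] at he
        rw [← he.1, ← he.2, hs, hs]
        exact hab
      · intro hpq
        exact ⟨_, hpq, by simp only [Prod.map_apply, hs]⟩
    rw [Set.mem_insert_iff, him]
    simp only [invSet, Set.mem_ofPred_eq, coe_mul_apply, Prod.mk.injEq]
    simp only [coe_simpleRefl_apply]
    have hinj := u.1.injective.eq_iff (a := i) (b := i + 1)
    split_ifs <;> subst_vars <;> grind
  have hinj : Function.Injective (Prod.map (simpleRefl i).1 (simpleRefl i).1) :=
    (simpleRefl i).1.injective.prodMap (simpleRefl i).1.injective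
  change (invSet _).ncard = (invSet _).ncard + 1
  rw [key, Set.ncard_insert_of_notMem ?_ ((invSet_finite u).image _),
    Set.ncard_image_of_injective _ hinj]
  · rintro ⟨⟨a, b⟩, hab, he⟩
    simp only [Prod.map_apply, Prod.mk.injEq, coe_simpleRefl_apply] at he
    obtain ⟨h1, h2⟩ := hab
    simp only at h1 h2
    grind

theorem len_mul_simpleRefl_of_gt {u : SInf} {i : ℕ} (h : u.1 (i + 1) < u.1 i) :
    len (u * simpleRefl i) + 1 = len u := by
  have := len_mul_simpleRefl_of_lt (u := u * simpleRefl i) (i := i) (by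
    rwa [mul_simpleRefl_apply_self, mul_simpleRefl_apply_succ])
  rw [mul_simpleRefl_mul_simpleRefl] at this
  exact this.symm

theorem apply_ne_apply_succ (u : SInf) (i : ℕ) : u.1 i ≠ u.1 (i + 1) := fun h => by
  have := u.1.injective h
  omega

theorem len_lt_len_mul_simpleRefl_iff (u : SInf) (i : ℕ) :
    len u < len (u * simpleRefl i) ↔ u.1 i < u.1 (i + 1) := by
  rcases lt_or_gt_of_ne (apply_ne_apply_succ u i) with h | h
  · simp [len_mul_simpleRefl_of_lt h, h]
  · have := len_mul_simpleRefl_of_gt h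
    omega

theorem len_inv (u : SInf) : len u⁻¹ = len u := by
  have key : invSet u⁻¹ = (fun p : ℕ × ℕ => (u.1 p.2, u.1 p.1)) '' invSet u := by
    ext ⟨p, q⟩
    constructor
    · rintro ⟨h1, h2⟩
      refine ⟨((u⁻¹).1 q, (u⁻¹).1 p), ⟨h2, ?_⟩, ?_⟩
      · simpa only [apply_inv_self'] using h1
      · simp only [apply_inv_self']
    · rintro ⟨⟨a, b⟩, ⟨h1, h2⟩, he⟩
      simp only [Prod.mk.injEq] at he
      obtain ⟨rfl, rfl⟩ := he
      exact ⟨h2, by simpa only [inv_apply_self'] using h1⟩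
  change (invSet _).ncard = (invSet _).ncard
  rw [key, Set.ncard_image_of_injective]
  rintro ⟨a, b⟩ ⟨c, d⟩ h
  simp only [Prod.mk.injEq, u.1.injective.eq_iff] at h
  rw [h.1, h.2]

theorem len_simpleRefl_mul (u : SInf) (i : ℕ) :
    len (simpleRefl i * u) = len (u⁻¹ * simpleRefl i) := by
  rw [← len_inv, simpleRefl_mul_inv]

theorem len_simpleRefl_mul_of_lt {u : SInf} {i : ℕ} (h : (u⁻¹).1 i < (u⁻¹).1 (i + 1)) :
    len (simpleRefl i * u) = len u + 1 := by
  rw [len_simpleRefl_mul, len_mul_simpleRefl_of_lt h, len_inv]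

theorem len_simpleRefl_mul_of_gt {u : SInf} {i : ℕ} (h : (u⁻¹).1 (i + 1) < (u⁻¹).1 i) :
    len (simpleRefl i * u) + 1 = len u := by
  rw [len_simpleRefl_mul, len_mul_simpleRefl_of_gt h, len_inv]

theorem len_one : len 1 = 0 := by
  have : invSet 1 = ∅ := by
    ext ⟨p, q⟩
    simp only [invSet, Set.mem_ofPred_eq, coe_one_apply, Set.mem_empty_iff_false, iff_false]
    omega
  change (invSet 1).ncard = 0
  rw [this, Set.ncard_empty]

theorem exists_descent {u : SInf} (h : u ≠ 1) : ∃ i, u.1 (i + 1) < u.1 i := by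
  by_contra hc
  push Not at hc
  have hm : StrictMono u.1 := strictMono_nat_of_lt_succ fun i =>
    lt_of_le_of_ne (hc i) (apply_ne_apply_succ u i)
  refine h (SInf.ext_apply fun j => le_antisymm ?_ (hm.le_apply))
  have hm' : StrictMono (u⁻¹).1 := fun a b hab => by
    by_contra hba
    have := hm.monotone (not_lt.1 hba)
    rw [apply_inv_self', apply_inv_self'] at this
    omega
  have := hm'.le_apply (x := u.1 j)
  rwa [inv_apply_self'] at this

theorem wordProd_nil : wordProd [] = 1 := rfl

theorem wordProd_cons (i : ℕ) (ω : List ℕ) : wordProd (i :: ω) = simpleRefl i * wordProd ω := by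
  simp [wordProd]

theorem wordProd_append (ω ω' : List ℕ) : wordProd (ω ++ ω') = wordProd ω * wordProd ω' := by
  simp [wordProd]

theorem len_simpleRefl_mul_le (u : SInf) (i : ℕ) : len (simpleRefl i * u) ≤ len u + 1 := by
  rcases lt_or_gt_of_ne (apply_ne_apply_succ u⁻¹ i) with h | h
  · exact (len_simpleRefl_mul_of_lt h).le
  · have := len_simpleRefl_mul_of_gt h
    omega

theorem len_wordProd_mul_le (ω : List ℕ) (u : SInf) :
    len (wordProd ω * u) ≤ ω.length + len u := by
  induction ω with
  | nil => simp [wordProd_nil]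
  | cons i ω ih =>
    rw [wordProd_cons, mul_assoc, List.length_cons]
    have := len_simpleRefl_mul_le (wordProd ω * u) i
    omega

theorem len_wordProd_le (ω : List ℕ) : len (wordProd ω) ≤ ω.length := by
  simpa [len_one] using len_wordProd_mul_le ω 1

theorem exists_word_length_eq (u : SInf) : ∃ ω, wordProd ω = u ∧ ω.length = len u := by
  induction h : len u generalizing u with
  | zero =>
    refine ⟨[], ?_, rfl⟩
    by_contra hu
    obtain ⟨i, hi⟩ := exists_descent (Ne.symm hu)
    have := len_mul_simpleRefl_of_gt hi
    omega
  | succ n ih =>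
    have hu : u⁻¹ ≠ 1 := by
      rintro hu
      rw [inv_eq_one] at hu
      rw [hu, len_one] at h
      omega
    obtain ⟨i, hi⟩ := exists_descent hu
    have := len_simpleRefl_mul_of_gt hi
    obtain ⟨ω, h1, h2⟩ := ih (simpleRefl i * u) (by omega)
    refine ⟨i :: ω, ?_, by simp [h2]⟩
    rw [wordProd_cons, h1, simpleRefl_mul_simpleRefl_mul]

theorem isReducedWord_iff {u : SInf} {ω : List ℕ} :
    IsReducedWord u ω ↔ wordProd ω = u ∧ ω.length = len u := by
  constructor
  · rintro ⟨h1, h2⟩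
    obtain ⟨ω', h3, h4⟩ := exists_word_length_eq u
    have h5 := h2 ω' h3
    have h6 := len_wordProd_le ω
    rw [h1] at h6
    exact ⟨h1, by omega⟩
  · rintro ⟨h1, h2⟩
    refine ⟨h1, fun ω' h3 => ?_⟩
    have := len_wordProd_le ω'
    rw [h3] at this
    omega

theorem len_mul_le (u v : SInf) : len (u * v) ≤ len u + len v := by
  obtain ⟨ω, rfl, h⟩ := exists_word_length_eq u
  rw [← h]
  exact len_wordProd_mul_le ω v

/-- The combinatorial form of the condition that `v t_{ab}` covers `v` in the Bruhat order, for
`a < b`; see `cover_iff`. -/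
def Cover (v : SInf) (a b : ℕ) : Prop :=
  v.1 a < v.1 b ∧ ∀ c, a < c → c < b → ¬ (v.1 a < v.1 c ∧ v.1 c < v.1 b)

theorem transp_succ_conj {a b : ℕ} (h : a + 1 < b) :
    simpleRefl a * transp (a + 1) b * simpleRefl a = transp a b := by
  refine SInf.ext_apply fun j => ?_
  simp only [coe_mul_apply, coe_transp_apply, coe_simpleRefl_apply]
  grind

/-- By induction on `b - a`, since `t_{ab}` is the conjugate of `t_{a+1,b}` by `s_a`. -/
theorem len_mul_transp_of_lt (d : ℕ) : ∀ (a : ℕ) (v : SInf), v.1 a < v.1 (a + d + 1) →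
    len v + 1 ≤ len (v * transp a (a + d + 1)) ∧
    (len (v * transp a (a + d + 1)) = len v + 1 ↔ Cover v a (a + d + 1)) := by
  induction d with
  | zero =>
    intro a v h
    have := len_mul_simpleRefl_of_lt h
    simp only [simpleRefl] at this
    simp only [add_zero]
    rw [this]
    exact ⟨le_rfl, iff_of_true rfl ⟨h, fun c _ _ => by omega⟩⟩
  | succ d ih =>
    intro a v h
    set b := a + (d + 1) + 1 with hb
    have hb' : b = a + 1 + d + 1 := by omega
    have e : v * transp a b = v * simpleRefl a * transp (a + 1) b * simpleRefl a := by
      rw [← transp_succ_conj (show a + 1 < b by omega)]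
      simp only [mul_assoc]
    have h1 : (v * simpleRefl a).1 (a + 1) < (v * simpleRefl a).1 b := by
      rw [mul_simpleRefl_apply, mul_simpleRefl_apply]
      simpa [show b ≠ a by omega, show b ≠ a + 1 by omega] using h
    obtain ⟨i1, i2⟩ := ih (a + 1) (v * simpleRefl a) (hb' ▸ h1)
    rw [← hb'] at i1 i2
    have hx1 : (v * simpleRefl a).1 (a + 1) = v.1 a := by
      rw [mul_simpleRefl_apply, if_neg (by omega), if_pos rfl]
    have hx : ∀ c, a + 1 < c → (v * simpleRefl a).1 c = v.1 c := fun c hc => by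
      rw [mul_simpleRefl_apply, if_neg (by omega), if_neg (by omega)]
    have hca : (v * simpleRefl a * transp (a + 1) b).1 a = v.1 (a + 1) := by
      rw [mul_transp_apply, if_neg (by omega), if_neg (by omega), mul_simpleRefl_apply,
        if_pos rfl]
    have hcb : (v * simpleRefl a * transp (a + 1) b).1 (a + 1) = v.1 b := by
      rw [mul_transp_apply, if_pos rfl, hx b (by omega)]
    have hcov : Cover v a b ↔ Cover (v * simpleRefl a) (a + 1) b ∧
        ¬ (v.1 a < v.1 (a + 1) ∧ v.1 (a + 1) < v.1 b) := by
      constructor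
      · rintro ⟨-, c2⟩
        refine ⟨⟨h1, fun c hc1 hc2 => ?_⟩, c2 (a + 1) (by omega) (by omega)⟩
        rw [hx1, hx c hc1, hx b (by omega)]
        exact c2 c (by omega) hc2
      · rintro ⟨⟨-, c2⟩, c3⟩
        refine ⟨h, fun c hc1 hc2 => ?_⟩
        by_cases hc : c = a + 1
        · rw [hc]; exact c3
        · have := c2 c (by omega) hc2
          rwa [hx1, hx c (by omega), hx b (by omega)] at this
    rw [e, hcov, ← i2]
    have n1 := apply_ne_apply_succ v a
    have n2 : v.1 (a + 1) ≠ v.1 b := fun h => by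
      have := v.1.injective h
      omega
    rcases lt_or_gt_of_ne n1 with g1 | g1
    · have l1 := len_mul_simpleRefl_of_lt g1
      rcases lt_or_gt_of_ne n2 with g2 | g2
      · have l2 := len_mul_simpleRefl_of_lt (u := v * simpleRefl a * transp (a + 1) b) (i := a)
          (by rw [hca, hcb]; exact g2)
        omega
      · have l2 := len_mul_simpleRefl_of_gt (u := v * simpleRefl a * transp (a + 1) b) (i := a)
          (by rw [hca, hcb]; exact g2)
        omega
    · have l1 := len_mul_simpleRefl_of_gt g1
      have l2 := len_mul_simpleRefl_of_lt (u := v * simpleRefl a * transp (a + 1) b) (i := a)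
          (by rw [hca, hcb]; omega)
      omega

theorem mul_transp_mul_transp (v : SInf) (a b : ℕ) : v * transp a b * transp a b = v := by
  rw [mul_assoc, transp_mul_self, mul_one]

theorem cover_iff {v : SInf} {a b : ℕ} (hab : a < b) :
    Cover v a b ↔ len (v * transp a b) = len v + 1 := by
  obtain ⟨d, rfl⟩ := Nat.exists_eq_add_of_lt hab
  by_cases h : v.1 a < v.1 (a + d + 1)
  · exact (len_mul_transp_of_lt d a v h).2.symm
  · refine iff_of_false (fun hc => h hc.1) fun hl => ?_
    have hne : v.1 a ≠ v.1 (a + d + 1) := fun h => by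
      have := v.1.injective h
      omega
    have := (len_mul_transp_of_lt d a (v * transp a (a + d + 1)) (by
      rw [mul_transp_apply, mul_transp_apply, if_pos rfl, if_neg (by omega), if_pos rfl]
      omega)).1
    rw [mul_transp_mul_transp] at this
    omega

open MvPolynomial

/-! ### Divided differences -/

section DividedDifferences

variable {R : Type*} [CommRing R]

theorem act_one (P : MvPolynomial ℕ R) : act 1 P = P := rename_id_apply P

theorem act_mul_perm (u v : SInf) (P : MvPolynomial ℕ R) : act (u * v) P = act u (act v P) :=
  (rename_rename v.1 u.1 P).symm

theorem act_mul (u : SInf) (P Q : MvPolynomial ℕ R) : act u (P * Q) = act u P * act u Q :=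
  map_mul (rename u.1) P Q

theorem act_add (u : SInf) (P Q : MvPolynomial ℕ R) : act u (P + Q) = act u P + act u Q :=
  map_add (rename u.1) P Q

theorem act_sub (u : SInf) (P Q : MvPolynomial ℕ R) : act u (P - Q) = act u P - act u Q :=
  map_sub (rename u.1) P Q

theorem act_prod {ι : Type*} (u : SInf) (s : Finset ι) (f : ι → MvPolynomial ℕ R) :
    act u (∏ i ∈ s, f i) = ∏ i ∈ s, act u (f i) :=
  map_prod (rename u.1) f s

theorem act_X (u : SInf) (i : ℕ) : act u (X i : MvPolynomial ℕ R) = X (u.1 i) := rename_X _ _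

theorem act_C (u : SInf) (r : R) : act u (C r) = C r := rename_C _ _

theorem map_act {S : Type*} [CommRing S] (φ : R →+* S) (u : SInf) (P : MvPolynomial ℕ R) :
    map φ (act u P) = act u (map φ P) :=
  map_rename φ u.1 P

theorem act_simpleRefl_X_self (i : ℕ) : act (simpleRefl i) (X i : MvPolynomial ℕ R) = X (i + 1) := by
  rw [act_X, coe_simpleRefl_apply, if_pos rfl]

theorem act_simpleRefl_X_succ (i : ℕ) : act (simpleRefl i) (X (i + 1) : MvPolynomial ℕ R) = X i := by
  rw [act_X, coe_simpleRefl_apply, if_neg (by omega), if_pos rfl]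

theorem act_simpleRefl_X_of_ne {i j : ℕ} (h1 : j ≠ i) (h2 : j ≠ i + 1) :
    act (simpleRefl i) (X j : MvPolynomial ℕ R) = X j := by
  rw [act_X, coe_simpleRefl_apply, if_neg h1, if_neg h2]

theorem act_eq_of_ddiff_eq_zero {i : ℕ} {P : MvPolynomial ℕ R} (h : ddiff i P = 0) :
    act (simpleRefl i) P = P := by
  have := ddiff_spec i P
  rw [h, mul_zero, sub_eq_zero] at this
  exact this.symm

variable [IsDomain R]

theorem X_sub_X_ne_zero {i j : ℕ} (h : i ≠ j) : (X i - X j : MvPolynomial ℕ R) ≠ 0 :=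
  sub_ne_zero.2 fun hx => h (X_injective hx)

theorem ddiff_eq_of {i : ℕ} {P Q : MvPolynomial ℕ R}
    (h : P - act (simpleRefl i) P = (X i - X (i + 1)) * Q) : ddiff i P = Q :=
  mul_left_cancel₀ (X_sub_X_ne_zero (by omega)) ((ddiff_spec i P).symm.trans h)

theorem ddiff_add (i : ℕ) (P Q : MvPolynomial ℕ R) : ddiff i (P + Q) = ddiff i P + ddiff i Q :=
  ddiff_eq_of (by rw [mul_add, ← ddiff_spec, ← ddiff_spec, act_add]; ring)

theorem ddiff_mul_of_act_eq {i : ℕ} {F : MvPolynomial ℕ R} (hF : act (simpleRefl i) F = F)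
    (P : MvPolynomial ℕ R) : ddiff i (F * P) = F * ddiff i P :=
  ddiff_eq_of (by rw [mul_left_comm, ← ddiff_spec, act_mul, hF]; ring)

theorem ddiff_C_mul (i : ℕ) (r : R) (P : MvPolynomial ℕ R) : ddiff i (C r * P) = C r * ddiff i P :=
  ddiff_mul_of_act_eq (act_C _ _) P

theorem ddiff_eq_zero_of_act_eq {i : ℕ} {P : MvPolynomial ℕ R} (h : act (simpleRefl i) P = P) :
    ddiff i P = 0 :=
  ddiff_eq_of (by rw [h, sub_self, mul_zero])

theorem ddiff_zero (i : ℕ) : ddiff i (0 : MvPolynomial ℕ R) = 0 :=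
  ddiff_eq_zero_of_act_eq (map_zero (rename _))

theorem act_ddiff (i : ℕ) (P : MvPolynomial ℕ R) : act (simpleRefl i) (ddiff i P) = ddiff i P := by
  refine (ddiff_eq_of ?_).symm
  have h := congrArg (act (simpleRefl i)) (ddiff_spec i P)
  rw [act_mul, act_sub, act_sub, ← act_mul_perm, simpleRefl_mul_self, act_one,
    act_simpleRefl_X_self, act_simpleRefl_X_succ] at h
  linear_combination -h

theorem ddiff_ddiff_self (i : ℕ) (P : MvPolynomial ℕ R) : ddiff i (ddiff i P) = 0 :=
  ddiff_eq_zero_of_act_eq (act_ddiff i P)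

theorem map_ddiff (φ : R →+* R) (i : ℕ) (P : MvPolynomial ℕ R) :
    map φ (ddiff i P) = ddiff i (map φ P) := by
  refine (ddiff_eq_of ?_).symm
  have h := congrArg (map φ) (ddiff_spec i P)
  simpa only [map_mul, map_sub, map_X, map_act] using h

theorem simpleRefl_comm {i j : ℕ} (h : i + 1 < j) :
    simpleRefl i * simpleRefl j = simpleRefl j * simpleRefl i := by
  refine SInf.ext_apply fun l => ?_
  simp only [coe_mul_apply, coe_simpleRefl_apply]
  grind

theorem simpleRefl_braid (i : ℕ) :
    simpleRefl i * (simpleRefl (i + 1) * simpleRefl i) =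
      simpleRefl (i + 1) * (simpleRefl i * simpleRefl (i + 1)) := by
  refine SInf.ext_apply fun l => ?_
  simp only [coe_mul_apply, coe_simpleRefl_apply]
  grind

theorem ddiff_comm {i j : ℕ} (h : i + 1 < j) (P : MvPolynomial ℕ R) :
    ddiff i (ddiff j P) = ddiff j (ddiff i P) := by
  have h1 := ddiff_spec i (ddiff j P)
  have h2 := ddiff_spec j (ddiff i P)
  have h3 := ddiff_spec i P
  have h4 := ddiff_spec j P
  have h5 := congrArg (act (simpleRefl i)) h4
  have h6 := congrArg (act (simpleRefl j)) h3
  rw [act_mul, act_sub, act_sub, act_simpleRefl_X_of_ne (by omega) (by omega),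
    act_simpleRefl_X_of_ne (by omega) (by omega), ← act_mul_perm] at h5 h6
  rw [simpleRefl_comm h] at h5
  refine mul_left_cancel₀ (X_sub_X_ne_zero (R := R) (show i ≠ i + 1 by omega))
    (mul_left_cancel₀ (X_sub_X_ne_zero (R := R) (show j ≠ j + 1 by omega)) ?_)
  linear_combination (-(X j - X (j + 1)) * h1 + (X i - X (i + 1)) * h2 + h3 - h4 + h5 - h6)

/-- The expansion of a threefold divided difference into the six elements of a dihedral group;
the right-hand side of the braid relation has the same expansion. -/
theorem braid_expansion {A : Type*} [CommRing A] (s t : A →+* A) {α β P R Q Z : A}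
    (sα : s α = -α) (sβ : s β = α + β) (tα : t α = α + β) (hR : P - s P = α * R) (hQ : R - t R = β * Q)
    (hZ : Q - s Q = α * Z) (sR : s R = R) :
    α * β * (α + β) * Z = P - s P - t P + t (s P) + s (t P) - s (t (s P)) := by
  have h1 := congrArg s hQ
  have h2 := congrArg t hR
  have h3 := congrArg s h2
  simp only [map_mul, map_sub, map_add, sα, sβ, tα, sR] at h1 h2 h3
  linear_combination (-β * (α + β)) * hZ - (α + β) * hQ + β * h1 - hR + h2 - h3

theorem ddiff_braid (i : ℕ) (P : MvPolynomial ℕ R) :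
    ddiff i (ddiff (i + 1) (ddiff i P)) = ddiff (i + 1) (ddiff i (ddiff (i + 1) P)) := by
  let s : MvPolynomial ℕ R →+* MvPolynomial ℕ R := (rename (simpleRefl i).1 : _ →ₐ[R] _)
  let t : MvPolynomial ℕ R →+* MvPolynomial ℕ R := (rename (simpleRefl (i + 1)).1 : _ →ₐ[R] _)
  have hs : ∀ F, s F = act (simpleRefl i) F := fun _ => rfl
  have ht : ∀ F, t F = act (simpleRefl (i + 1)) F := fun _ => rfl
  have e1 := act_simpleRefl_X_self (R := R) i
  have e2 := act_simpleRefl_X_succ (R := R) i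
  have e3 := act_simpleRefl_X_self (R := R) (i + 1)
  have e4 := act_simpleRefl_X_succ (R := R) (i + 1)
  have e5 := act_simpleRefl_X_of_ne (R := R) (i := i) (j := i + 1 + 1) (by omega) (by omega)
  have e6 := act_simpleRefl_X_of_ne (R := R) (i := i + 1) (j := i) (by omega) (by omega)
  have k1 := braid_expansion s t (α := X i - X (i + 1)) (β := X (i + 1) - X (i + 1 + 1))
    (by rw [hs, act_sub, e1, e2]; ring) (by rw [hs, act_sub, e2, e5]; ring)
    (by rw [ht, act_sub, e6, e3]; ring) (ddiff_spec i P) (ddiff_spec (i + 1) (ddiff i P))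
    (ddiff_spec i (ddiff (i + 1) (ddiff i P))) (act_ddiff i P)
  have k2 := braid_expansion t s (α := X (i + 1) - X (i + 1 + 1)) (β := X i - X (i + 1))
    (by rw [ht, act_sub, e3, e4]; ring) (by rw [ht, act_sub, e6, e3]; ring)
    (by rw [hs, act_sub, e2, e5]; ring) (ddiff_spec (i + 1) P) (ddiff_spec i (ddiff (i + 1) P))
    (ddiff_spec (i + 1) (ddiff i (ddiff (i + 1) P))) (act_ddiff (i + 1) P)
  have k3 : s (t (s P)) = t (s (t P)) := by
    simp only [hs, ht, ← act_mul_perm, simpleRefl_braid]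
  have h0 : (X i - X (i + 1 + 1) : MvPolynomial ℕ R) ≠ 0 := X_sub_X_ne_zero (by omega)
  refine mul_left_cancel₀ (mul_ne_zero (mul_ne_zero (X_sub_X_ne_zero (R := R)
    (show i ≠ i + 1 by omega)) (X_sub_X_ne_zero (R := R) (show i + 1 ≠ i + 1 + 1 by omega))) h0) ?_
  linear_combination k1 - k2 - k3

/-- The operators attached to two reduced words of a permutation agree. -/
theorem foldr_ddiff_eq (n : ℕ) : ∀ ω ω' : List ℕ, ω.length = n → ω'.length = n →
    wordProd ω = wordProd ω' → len (wordProd ω) = n → ∀ P : MvPolynomial ℕ R,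
    ω.foldr ddiff P = ω'.foldr ddiff P := by
  induction n with
  | zero =>
    intro ω ω' h1 h2 _ _ P
    rw [List.length_eq_zero_iff.1 h1, List.length_eq_zero_iff.1 h2]
  | succ n ih =>
    -- the case of two distinct first letters, in increasing order
    have main : ∀ (i j : ℕ) (ω ω' : List ℕ), i < j → ω.length = n → ω'.length = n →
        wordProd (i :: ω) = wordProd (j :: ω') → len (wordProd (i :: ω)) = n + 1 →
        ∀ P : MvPolynomial ℕ R, (i :: ω).foldr ddiff P = (j :: ω').foldr ddiff P := by
      intro i j ω ω' hij h1 h2 he hl P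
      set u := wordProd (i :: ω) with hu
      have g1 : wordProd ω = simpleRefl i * u := by
        rw [hu, wordProd_cons, simpleRefl_mul_simpleRefl_mul]
      have g2 : wordProd ω' = simpleRefl j * u := by
        rw [he, wordProd_cons, simpleRefl_mul_simpleRefl_mul]
      have d1 : (u⁻¹).1 (i + 1) < (u⁻¹).1 i := by
        by_contra hc
        have := len_simpleRefl_mul_of_lt (u := u) (i := i)
          (lt_of_le_of_ne (not_lt.1 hc) (apply_ne_apply_succ _ _))
        have := len_wordProd_le ω
        rw [g1] at this
        omega
      have d2 : (u⁻¹).1 (j + 1) < (u⁻¹).1 j := by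
        by_contra hc
        have := len_simpleRefl_mul_of_lt (u := u) (i := j)
          (lt_of_le_of_ne (not_lt.1 hc) (apply_ne_apply_succ _ _))
        have := len_wordProd_le ω'
        rw [g2] at this
        omega
      have l1 := len_simpleRefl_mul_of_gt d1
      have l2 := len_simpleRefl_mul_of_gt d2
      rcases Nat.lt_or_ge (i + 1) j with hj | hj
      · have l3 := len_simpleRefl_mul_of_gt (u := simpleRefl i * u) (i := j) (by
          rwa [simpleRefl_mul_inv, mul_simpleRefl_apply_of_ne _ (by omega) (by omega),
            mul_simpleRefl_apply_of_ne _ (by omega) (by omega)])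
        obtain ⟨ω₀, h3, h4⟩ := exists_word_length_eq (simpleRefl j * (simpleRefl i * u))
        have hω : ω.foldr ddiff P = (j :: ω₀).foldr ddiff P := by
          refine ih _ _ h1 (by rw [List.length_cons]; omega) ?_ (by rw [g1]; omega) P
          rw [wordProd_cons, h3, g1, simpleRefl_mul_simpleRefl_mul]
        have hω' : ω'.foldr ddiff P = (i :: ω₀).foldr ddiff P := by
          refine ih _ _ h2 (by rw [List.length_cons]; omega) ?_ (by rw [g2]; omega) P
          rw [wordProd_cons, h3, g2, ← mul_assoc (simpleRefl j), ← simpleRefl_comm hj, mul_assoc,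
            simpleRefl_mul_simpleRefl_mul]
        rw [List.foldr_cons, List.foldr_cons, hω, hω', List.foldr_cons, List.foldr_cons,
          ddiff_comm hj]
      · obtain rfl : j = i + 1 := by omega
        have l3 := len_simpleRefl_mul_of_gt (u := simpleRefl i * u) (i := i + 1) (by
          rw [simpleRefl_mul_inv, mul_simpleRefl_apply_of_ne _ (by omega) (by omega),
            mul_simpleRefl_apply_succ]
          omega)
        have l4 := len_simpleRefl_mul_of_gt (u := simpleRefl (i + 1) * (simpleRefl i * u)) (i := i)
          (by
            rwa [simpleRefl_mul_inv, simpleRefl_mul_inv, mul_simpleRefl_apply_self,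
              mul_simpleRefl_apply_of_ne _ (by omega) (by omega),
              mul_simpleRefl_apply_of_ne _ (by omega) (by omega), mul_simpleRefl_apply_self])
        obtain ⟨ω₀, h3, h4⟩ :=
          exists_word_length_eq (simpleRefl i * (simpleRefl (i + 1) * (simpleRefl i * u)))
        have hω : ω.foldr ddiff P = ((i + 1) :: i :: ω₀).foldr ddiff P := by
          refine ih _ _ h1 (by simp only [List.length_cons]; omega) ?_ (by rw [g1]; omega) P
          rw [wordProd_cons, wordProd_cons, h3, g1, simpleRefl_mul_simpleRefl_mul,
            simpleRefl_mul_simpleRefl_mul]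
        have hω' : ω'.foldr ddiff P = (i :: (i + 1) :: ω₀).foldr ddiff P := by
          refine ih _ _ h2 (by simp only [List.length_cons]; omega) ?_ (by rw [g2]; omega) P
          have hb : simpleRefl i * (simpleRefl (i + 1) * (simpleRefl i * u)) =
              simpleRefl (i + 1) * (simpleRefl i * (simpleRefl (i + 1) * u)) := by
            simpa only [mul_assoc] using congrArg (· * u) (simpleRefl_braid i)
          rw [wordProd_cons, wordProd_cons, h3, g2, hb, simpleRefl_mul_simpleRefl_mul,
            simpleRefl_mul_simpleRefl_mul]
        rw [List.foldr_cons, List.foldr_cons, hω, hω']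
        simp only [List.foldr_cons]
        exact ddiff_braid i _
    intro ω ω' h1 h2 he hl P
    match ω, ω', h1, h2 with
    | i :: ω, j :: ω', h1, h2 =>
      rw [List.length_cons, Nat.add_right_cancel_iff] at h1 h2
      rcases lt_trichotomy i j with hij | rfl | hij
      · exact main i j ω ω' hij h1 h2 he hl P
      · rw [List.foldr_cons, List.foldr_cons]
        congr 1
        have he' := he
        rw [wordProd_cons, wordProd_cons, mul_right_inj] at he'
        refine ih ω ω' h1 h2 he' ?_ P
        have a1 := len_wordProd_le ω
        have a2 := len_simpleRefl_mul_le (wordProd ω) i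
        rw [wordProd_cons] at hl
        omega
      · exact (main j i ω' ω hij h2 h1 he.symm (he ▸ hl) P).symm

theorem ddiffPerm_eq_foldr {u : SInf} {ω : List ℕ} (h1 : wordProd ω = u) (h2 : ω.length = len u)
    (P : MvPolynomial ℕ R) : ddiffPerm u P = ω.foldr ddiff P := by
  obtain ⟨h3, h4⟩ := isReducedWord_iff.1 (reducedWord_spec u)
  exact foldr_ddiff_eq (len u) _ _ h4 h2 (h3.trans h1.symm) (by rw [h3]) P

theorem ddiffPerm_one (P : MvPolynomial ℕ R) : ddiffPerm 1 P = P :=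
  ddiffPerm_eq_foldr (ω := []) wordProd_nil (by rw [len_one]; rfl) P

theorem ddiffPerm_mul {u v : SInf} (h : len (u * v) = len u + len v) (P : MvPolynomial ℕ R) :
    ddiffPerm (u * v) P = ddiffPerm u (ddiffPerm v P) := by
  obtain ⟨ω, h1, h2⟩ := exists_word_length_eq u
  obtain ⟨ω', h3, h4⟩ := exists_word_length_eq v
  rw [ddiffPerm_eq_foldr h1 h2, ddiffPerm_eq_foldr h3 h4, ← List.foldr_append]
  exact ddiffPerm_eq_foldr (by rw [wordProd_append, h1, h3])
    (by rw [List.length_append, h2, h4, h]) P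

theorem len_simpleRefl (i : ℕ) : len (simpleRefl i) = 1 := by
  have := len_mul_simpleRefl_of_lt (u := 1) (i := i) (by simp)
  rwa [one_mul, len_one] at this

theorem ddiffPerm_simpleRefl (i : ℕ) (P : MvPolynomial ℕ R) :
    ddiffPerm (simpleRefl i) P = ddiff i P :=
  ddiffPerm_eq_foldr (ω := [i]) (by rw [wordProd_cons, wordProd_nil, mul_one])
    (by rw [len_simpleRefl]; rfl) P

theorem ddiffPerm_simpleRefl_mul {u : SInf} {i : ℕ} (h : (u⁻¹).1 i < (u⁻¹).1 (i + 1))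
    (P : MvPolynomial ℕ R) : ddiffPerm (simpleRefl i * u) P = ddiff i (ddiffPerm u P) := by
  rw [ddiffPerm_mul (by rw [len_simpleRefl_mul_of_lt h, len_simpleRefl, add_comm]),
    ddiffPerm_simpleRefl]

theorem ddiff_ddiffPerm_eq_zero {u : SInf} {i : ℕ} (h : (u⁻¹).1 (i + 1) < (u⁻¹).1 i)
    (P : MvPolynomial ℕ R) : ddiff i (ddiffPerm u P) = 0 := by
  have := ddiffPerm_simpleRefl_mul (u := simpleRefl i * u) (i := i) (by
    rwa [simpleRefl_mul_inv, mul_simpleRefl_apply_self, mul_simpleRefl_apply_succ]) P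
  rw [simpleRefl_mul_simpleRefl_mul] at this
  rw [this, ddiff_ddiff_self]

theorem ddiffPerm_mul_simpleRefl {u : SInf} {i : ℕ} (h : u.1 i < u.1 (i + 1))
    (P : MvPolynomial ℕ R) : ddiffPerm (u * simpleRefl i) P = ddiffPerm u (ddiff i P) := by
  rw [ddiffPerm_mul (by rw [len_mul_simpleRefl_of_lt h, len_simpleRefl]), ddiffPerm_simpleRefl]

theorem ddiffPerm_zero (u : SInf) : ddiffPerm u (0 : MvPolynomial ℕ R) = 0 := by
  unfold ddiffPerm
  induction reducedWord u with
  | nil => rfl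
  | cons i ω ih => rw [List.foldr_cons, ih, ddiff_zero]

theorem ddiffPerm_add (u : SInf) (P Q : MvPolynomial ℕ R) :
    ddiffPerm u (P + Q) = ddiffPerm u P + ddiffPerm u Q := by
  unfold ddiffPerm
  induction reducedWord u with
  | nil => rfl
  | cons i ω ih => rw [List.foldr_cons, ih, ddiff_add]; rfl

theorem ddiffPerm_C_mul (u : SInf) (r : R) (P : MvPolynomial ℕ R) :
    ddiffPerm u (C r * P) = C r * ddiffPerm u P := by
  unfold ddiffPerm
  induction reducedWord u with
  | nil => rfl
  | cons i ω ih => rw [List.foldr_cons, ih, ddiff_C_mul]; rfl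

theorem map_ddiffPerm (φ : R →+* R) (u : SInf) (P : MvPolynomial ℕ R) :
    map φ (ddiffPerm u P) = ddiffPerm u (map φ P) := by
  unfold ddiffPerm
  induction reducedWord u with
  | nil => rfl
  | cons i ω ih => rw [List.foldr_cons, map_ddiff, ih]; rfl

theorem ddiffPerm_ddiff_eq_zero {u : SInf} {i : ℕ} (h : u.1 (i + 1) < u.1 i)
    (P : MvPolynomial ℕ R) : ddiffPerm u (ddiff i P) = 0 := by
  have := ddiffPerm_mul_simpleRefl (u := u * simpleRefl i) (i := i) (by
    rwa [mul_simpleRefl_apply_self, mul_simpleRefl_apply_succ]) (ddiff i P)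
  rw [mul_simpleRefl_mul_simpleRefl, ddiff_ddiff_self, ddiffPerm_zero] at this
  exact this

end DividedDifferences

/-! ### Codes -/

theorem code_le_of_memS {n : ℕ} {v : SInf} (hv : MemS n v) (i : ℕ) : code v i ≤ n - i := by
  have h : {j | i < j ∧ v.1 j < v.1 i} ⊆ (Finset.Ioc i n : Finset ℕ) := by
    rintro j ⟨h1, h2⟩
    have : j ≤ n := by
      by_contra hc
      rw [hv j (by omega)] at h2
      by_cases hi : i ≤ n
      · have := hv.apply_le hi; omega
      · rw [hv i (by omega)] at h2; omega
    simp only [Finset.coe_Ioc, Set.mem_Ioc]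
    omega
  refine (Set.ncard_le_ncard h (Finset.finite_toSet _)).trans ?_
  rw [Set.ncard_coe_finset, Nat.card_Ioc]

theorem code_lt_of_gt {v : SInf} {i : ℕ} (h : v.1 (i + 1) < v.1 i) : code v (i + 1) < code v i := by
  refine Set.ncard_lt_ncard ⟨?_, fun hs => ?_⟩ (code_set_finite v i)
  · rintro j ⟨h1, h2⟩
    exact ⟨by omega, by omega⟩
  · have := hs (a := i + 1) ⟨by omega, h⟩
    exact absurd this.1 (by omega)

theorem code_le_code_succ_iff {v : SInf} {i : ℕ} :
    code v i ≤ code v (i + 1) ↔ v.1 i < v.1 (i + 1) := by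
  constructor
  · intro h
    by_contra hc
    have := code_lt_of_gt (v := v) (i := i)
      (lt_of_le_of_ne (not_lt.1 hc) (apply_ne_apply_succ v i).symm)
    omega
  · intro h
    refine Set.ncard_le_ncard ?_ (code_set_finite v (i + 1))
    rintro j ⟨h1, h2⟩
    refine ⟨?_, by omega⟩
    rcases eq_or_ne j (i + 1) with rfl | hj
    · omega
    · omega

/-- An entry of the code depends only on the value at its position and the set of the values to
the right of it. -/
theorem code_eq_of_forall {v w : SInf} {i : ℕ} (hi : v.1 i = w.1 i)
    (h : ∀ q, i < (v⁻¹).1 q ↔ i < (w⁻¹).1 q) : code v i = code w i := by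
  have key : ∀ u : SInf, code u i = {q | i < (u⁻¹).1 q ∧ q < u.1 i}.ncard := fun u => by
    have : {q | i < (u⁻¹).1 q ∧ q < u.1 i} = u.1 '' {j | i < j ∧ u.1 j < u.1 i} := by
      ext q
      constructor
      · rintro ⟨h1, h2⟩
        exact ⟨(u⁻¹).1 q, ⟨h1, by rwa [apply_inv_self']⟩, apply_inv_self' u q⟩
      · rintro ⟨j, ⟨h1, h2⟩, rfl⟩
        exact ⟨by rwa [inv_apply_self'], h2⟩
    rw [this, Set.ncard_image_of_injective _ u.1.injective]
    rfl
  rw [key, key]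
  congr 1
  ext q
  simp only [Set.mem_ofPred_eq, h q, hi]

/-- Multiplying by a transposition of two positions changes no entry of the code before them. -/
theorem code_mul_transp_of_lt (v : SInf) {a b j : ℕ} (ha : j < a) (hb : j < b) :
    code (v * transp a b) j = code v j := by
  refine code_eq_of_forall ?_ fun q => ?_
  · rw [mul_transp_apply, if_neg (by omega), if_neg (by omega)]
  · have : (v * transp a b)⁻¹ = transp a b * v⁻¹ := by
      rw [mul_inv_rev, inv_eq_of_mul_eq_one_left (transp_mul_self a b)]
    rw [this, coe_mul_apply, coe_transp_apply]
    split_ifs <;> omega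

theorem code_mul_simpleRefl_of_ne (v : SInf) {i j : ℕ} (h1 : j ≠ i) (h2 : j ≠ i + 1) :
    code (v * simpleRefl i) j = code v j := by
  rcases Nat.lt_or_ge j i with h | h
  · exact code_mul_transp_of_lt v h (by omega)
  · unfold code
    congr 1
    ext l
    simp only [Set.mem_ofPred_eq]
    refine and_congr_right fun hl => ?_
    rw [mul_simpleRefl_apply_of_ne v h1 h2, mul_simpleRefl_apply_of_ne v (by omega) (by omega)]

theorem code_mul_simpleRefl_self {v : SInf} {i : ℕ} (h : v.1 i < v.1 (i + 1)) :
    code (v * simpleRefl i) i = code v (i + 1) + 1 := by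
  have : {j | i < j ∧ (v * simpleRefl i).1 j < (v * simpleRefl i).1 i} =
      insert (i + 1) {j | i + 1 < j ∧ v.1 j < v.1 (i + 1)} := by
    ext j
    simp only [Set.mem_ofPred_eq, Set.mem_insert_iff, mul_simpleRefl_apply_self]
    rcases eq_or_ne j (i + 1) with rfl | hj
    · rw [mul_simpleRefl_apply_succ]
      simp [h]
    · rcases eq_or_ne j i with rfl | hj'
      · simp
      · rw [mul_simpleRefl_apply_of_ne v hj' hj]
        omega
  unfold code
  rw [this, Set.ncard_insert_of_notMem (by simp) (code_set_finite v (i + 1))]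

theorem code_mul_simpleRefl_succ {v : SInf} {i : ℕ} (h : v.1 i < v.1 (i + 1)) :
    code (v * simpleRefl i) (i + 1) = code v i := by
  unfold code
  congr 1
  ext j
  simp only [Set.mem_ofPred_eq, mul_simpleRefl_apply_succ]
  rcases eq_or_ne j (i + 1) with rfl | hj
  · omega
  · rcases eq_or_ne j i with rfl | hj'
    · omega
    · rw [mul_simpleRefl_apply_of_ne v hj' hj]
      omega

theorem w0_apply_of_le {n i : ℕ} (h : i ≤ n) : (w0 n).1 i = n - i := if_pos h

theorem w0_apply_of_gt {n i : ℕ} (h : n < i) : (w0 n).1 i = i := if_neg (by omega)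

theorem memS_w0 (n : ℕ) : MemS n (w0 n) := fun _ h => w0_apply_of_gt h

theorem w0_mul_self (n : ℕ) : w0 n * w0 n = 1 := by
  refine SInf.ext_apply fun j => ?_
  rw [coe_mul_apply, coe_one_apply]
  by_cases h : j ≤ n
  · rw [w0_apply_of_le h, w0_apply_of_le (by omega)]
    omega
  · rw [w0_apply_of_gt (i := j) (by omega), w0_apply_of_gt (by omega)]

theorem simpleRefl_mul_w0 {n i : ℕ} (h : i < n) :
    simpleRefl i * w0 n = w0 n * simpleRefl (n - 1 - i) := by
  refine SInf.ext_apply fun j => ?_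
  rw [coe_mul_apply, mul_simpleRefl_apply, coe_simpleRefl_apply]
  rcases Nat.lt_or_ge n j with hj | hj
  · rw [w0_apply_of_gt hj, if_neg (by omega), if_neg (by omega), if_neg (by omega),
      if_neg (by omega)]
  · rw [w0_apply_of_le hj, w0_apply_of_le (by omega), w0_apply_of_le (by omega)]
    split_ifs <;> omega

/-- The longest element is the only element of `S_{n+1}` without ascents in `S_{n+1}`. -/
theorem eq_w0_of_forall_gt {n : ℕ} {v : SInf} (hv : MemS n v)
    (h : ∀ i < n, v.1 (i + 1) < v.1 i) : v = w0 n := by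
  have h1 : ∀ i ≤ n, v.1 i ≤ n - i := by
    intro i
    induction i with
    | zero => exact fun _ => hv.apply_le (Nat.zero_le n)
    | succ i ih => exact fun hi => by have := ih (by omega); have := h i (by omega); omega
  have h2 : ∀ d ≤ n, d ≤ v.1 (n - d) := by
    intro d
    induction d with
    | zero => exact fun _ => Nat.zero_le _
    | succ d ih =>
      intro hd
      have h3 := ih (by omega)
      have h4 := h (n - (d + 1)) (by omega)
      rw [show n - (d + 1) + 1 = n - d by omega] at h4
      omega
  refine SInf.ext_apply fun j => ?_
  rcases Nat.lt_or_ge n j with hj | hj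
  · rw [hv j hj, w0_apply_of_gt hj]
  · have h3 := h1 j hj
    have h4 := h2 (n - j) (by omega)
    rw [show n - (n - j) = j by omega] at h4
    rw [w0_apply_of_le hj]
    omega

theorem code_w0 (n i : ℕ) : code (w0 n) i = n - i := by
  have : {j | i < j ∧ (w0 n).1 j < (w0 n).1 i} = (Finset.Ioc i n : Finset ℕ) := by
    ext j
    simp only [Set.mem_ofPred_eq, Finset.coe_Ioc, Set.mem_Ioc]
    refine and_congr_right fun hj => ?_
    rcases Nat.lt_or_ge n j with h | h
    · rw [w0_apply_of_gt h]
      rcases Nat.lt_or_ge n i with h' | h'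
      · rw [w0_apply_of_gt h']; omega
      · rw [w0_apply_of_le h']; omega
    · rw [w0_apply_of_le h, w0_apply_of_le (by omega)]; omega
  unfold code
  rw [this, Set.ncard_coe_finset, Nat.card_Ioc]

/-! ### Double Schubert polynomials -/

section Schubert

variable {R : Type*} [CommRing R]

/-- The product of the factors `x_i - a_j` over the cells `(i, j)`, `j < c i`, of a diagram with
`N` rows. -/
noncomputable def diagramProd (a : ℕ → R) (N : ℕ) (c : ℕ → ℕ) : MvPolynomial ℕ R :=
  ∏ i ∈ Finset.range N, ∏ j ∈ Finset.range (c i), (X i - C (a j))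

theorem diagramProd_congr {a : ℕ → R} {N : ℕ} {c c' : ℕ → ℕ} (h : ∀ i < N, c i = c' i) :
    diagramProd a N c = diagramProd a N c' :=
  Finset.prod_congr rfl fun i hi => by rw [h i (Finset.mem_range.1 hi)]

theorem diagramProd_mono {a : ℕ → R} {N N' : ℕ} {c : ℕ → ℕ} (hN : N ≤ N')
    (h : ∀ i, N ≤ i → c i = 0) : diagramProd a N' c = diagramProd a N c := by
  refine (Finset.prod_subset (Finset.range_mono hN) fun i _ hi => ?_).symm
  rw [h i (by simpa using hi), Finset.range_zero, Finset.prod_empty]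

theorem schubTop_eq (a : ℕ → R) (n : ℕ) : schubTop a n = diagramProd a n (fun i => n - i) := by
  unfold schubTop diagramProd
  rw [Finset.prod_filter, Finset.prod_product]
  refine Finset.prod_congr rfl fun i hi => ?_
  rw [← Finset.prod_filter]
  refine Finset.prod_congr ?_ fun _ _ => rfl
  ext j
  simp only [Finset.mem_filter, Finset.mem_range] at hi ⊢
  omega

theorem diagramProd_update {a : ℕ → R} {N i : ℕ} {c : ℕ → ℕ} (hi : i < N) {m : ℕ}
    (h : c i = m + 1) :
    diagramProd a N c = (X i - C (a m)) * diagramProd a N (Function.update c i m) := by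
  unfold diagramProd
  rw [← Finset.mul_prod_erase _ _ (Finset.mem_range.2 hi),
    ← Finset.mul_prod_erase _ (fun l => ∏ j ∈ Finset.range (Function.update c i m l), _)
      (Finset.mem_range.2 hi), h, Finset.prod_range_succ, Function.update_self]
  have : ∏ l ∈ (Finset.range N).erase i, ∏ j ∈ Finset.range (Function.update c i m l),
      (X l - C (a j)) = ∏ l ∈ (Finset.range N).erase i, ∏ j ∈ Finset.range (c l),
      (X l - C (a j) : MvPolynomial ℕ R) :=
    Finset.prod_congr rfl fun l hl => by rw [Function.update_of_ne (Finset.ne_of_mem_erase hl)]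
  rw [this]
  ring

theorem act_diagramProd {a : ℕ → R} {N i : ℕ} {c : ℕ → ℕ} (hi : i + 1 < N)
    (h : c i = c (i + 1)) :
    act (simpleRefl i) (diagramProd a N c) = diagramProd a N c := by
  unfold diagramProd
  rw [act_prod]
  have hs := simpleRefl_apply_apply i
  have hr : ∀ j ∈ Finset.range N, (simpleRefl i).1 j ∈ Finset.range N := fun j hj => by
    rw [Finset.mem_range] at hj ⊢
    rw [coe_simpleRefl_apply]
    split_ifs <;> omega
  refine Finset.prod_nbij' (simpleRefl i).1 (simpleRefl i).1 hr hr (fun j _ => hs j)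
    (fun j _ => hs j) fun j _ => ?_
  have hc : c ((simpleRefl i).1 j) = c j := by
    rw [coe_simpleRefl_apply]
    split_ifs with h1 h2
    · rw [h1, h]
    · rw [h2, h]
    · rfl
  rw [act_prod, hc]
  refine Finset.prod_congr rfl fun l _ => ?_
  rw [act_sub, act_X, act_C]

variable [IsDomain R]

/-- Removing a cell from row `i` of a diagram by `∂_i`. -/
theorem ddiff_diagramProd {a : ℕ → R} {N i : ℕ} {c : ℕ → ℕ} (hi : i + 1 < N)
    (h : c i = c (i + 1) + 1) :
    ddiff i (diagramProd a N c) = diagramProd a N (Function.update c i (c (i + 1))) := by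
  refine ddiff_eq_of ?_
  rw [diagramProd_update (by omega) h, act_mul, act_diagramProd hi, act_sub, act_C,
    act_simpleRefl_X_self]
  · ring
  · rw [Function.update_self, Function.update_of_ne (by omega)]

/-- Enlarging `n` does not change `∂^{u⁻¹ w_0(n)} 𝔖_{w_0(n)}`: here `w_0(n) w_0(n+1)` is the cycle
`s_n ⋯ s_0`, and `∂_0, …, ∂_n` in turn remove the last cell of each row of the staircase. -/
theorem ddiffPerm_schubTop_succ (a : ℕ → R) {n : ℕ} {u : SInf} (hu : MemS n u) :
    ddiffPerm (u⁻¹ * w0 (n + 1)) (schubTop a (n + 1)) =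
      ddiffPerm (u⁻¹ * w0 n) (schubTop a n) := by
  set g := u⁻¹ * w0 (n + 1) with hg
  have hui := hu.inv
  have g0 : g.1 0 = n + 1 := by
    rw [hg, coe_mul_apply, w0_apply_of_le (by omega), hui _ (by omega)]
    rfl
  have gs : ∀ j ≤ n, g.1 (j + 1) ≤ n := fun j hj => by
    rw [hg, coe_mul_apply, w0_apply_of_le (by omega)]
    exact hui.apply_le (by omega)
  -- the staircase of `w_0(n+1)` with the last cells of the first `m` rows removed
  let F : ℕ → MvPolynomial ℕ R := fun m =>
    diagramProd a (n + 2) fun i => if i < m then n - i else n + 1 - i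
  -- `∂^{h m}` remains to be applied to `F m`, where `h m = g s_0 ⋯ s_{m-1}`
  let h : ℕ → SInf := fun m => g * wordProd (List.range m)
  have hsucc : ∀ m, h (m + 1) = h m * simpleRefl m := fun m => by
    simp only [h, List.range_succ, wordProd_append, wordProd_cons, wordProd_nil, mul_one, mul_assoc]
  have hval : ∀ m j, (h m).1 j = if j < m then g.1 (j + 1) else if j = m then g.1 0 else g.1 j := by
    intro m
    induction m with
    | zero =>
      intro j
      simp only [h, List.range_zero, wordProd_nil, mul_one]
      split_ifs with h1 h2
      · omega
      · rw [h2]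
      · rfl
    | succ m ih =>
      intro j
      rw [hsucc, mul_simpleRefl_apply]
      rcases lt_trichotomy j m with hj | rfl | hj
      · rw [if_neg (by omega), if_neg (by omega), ih, if_pos hj, if_pos (by omega)]
      · rw [if_pos rfl, ih, if_neg (by omega), if_neg (by omega), if_pos (by omega)]
      · rw [if_neg (by omega), if_neg (show ¬ j < m + 1 by omega)]
        split_ifs with h1
        · rw [ih, if_neg (by omega), if_pos rfl]
        · rw [ih, if_neg (by omega), if_neg (by omega)]
  have hstep : ∀ m ≤ n, ddiffPerm (h m) (F m) = ddiffPerm (h (m + 1)) (F (m + 1)) := by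
    intro m hm
    have e1 : ddiff m (F m) = F (m + 1) := by
      refine (ddiff_diagramProd (by omega) ?_).trans (diagramProd_congr fun i hi => ?_)
      · rw [if_neg (by omega), if_neg (by omega)]
        omega
      · rcases eq_or_ne i m with rfl | him
        · rw [Function.update_self, if_neg (by omega), if_pos (by omega)]
          omega
        · rw [Function.update_of_ne him]
          split_ifs <;> omega
    have e2 : h m = h (m + 1) * simpleRefl m := by
      rw [hsucc, mul_simpleRefl_mul_simpleRefl]
    rw [← e1, e2, ddiffPerm_mul_simpleRefl]
    have := gs m hm
    rw [hval, hval, if_pos (by omega), if_neg (by omega), if_pos rfl]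
    omega
  have hall : ∀ m ≤ n + 1, ddiffPerm (h 0) (F 0) = ddiffPerm (h m) (F m) := by
    intro m
    induction m with
    | zero => exact fun _ => rfl
    | succ m ih => exact fun hm => (ih (by omega)).trans (hstep m (by omega))
  have hend : h (n + 1) = u⁻¹ * w0 n := by
    refine SInf.ext_apply fun j => ?_
    rw [hval]
    rcases lt_trichotomy j (n + 1) with hj | rfl | hj
    · rw [if_pos hj, hg, coe_mul_apply, coe_mul_apply, w0_apply_of_le (by omega),
        w0_apply_of_le (by omega)]
      congr 1
      omega
    · rw [if_neg (by omega), if_pos rfl, g0, coe_mul_apply, w0_apply_of_gt (by omega),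
        hui _ (by omega)]
    · rw [if_neg (by omega), if_neg (by omega), hg, coe_mul_apply, coe_mul_apply,
        w0_apply_of_gt hj, w0_apply_of_gt (by omega)]
  have hF0 : F 0 = schubTop a (n + 1) := by
    rw [schubTop_eq, ← diagramProd_mono (show n + 1 ≤ n + 2 by omega) fun i hi => by omega]
    exact diagramProd_congr fun i _ => if_neg (by omega)
  have hF1 : F (n + 1) = schubTop a n := by
    rw [schubTop_eq, ← diagramProd_mono (show n ≤ n + 2 by omega) fun i hi => by omega]
    refine diagramProd_congr fun i _ => ?_
    split_ifs <;> omega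
  have := hall (n + 1) le_rfl
  rw [hend, hF0, hF1] at this
  rw [← this]
  simp only [h, List.range_zero, wordProd_nil, mul_one]

theorem schub_eq (a : ℕ → R) {n : ℕ} (hn : 0 < n) {u : SInf} (hu : MemS n u) :
    schub a u = ddiffPerm (u⁻¹ * w0 n) (schubTop a n) := by
  classical
  have hle : Nat.find (exists_memS u) ≤ n := Nat.find_min' _ ⟨hn, hu⟩
  have hm := (Nat.find_spec (exists_memS u)).2
  unfold schub
  generalize Nat.find (exists_memS u) = m at hle hm ⊢
  induction n, hle using Nat.le_induction with
  | base => rfl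
  | succ n hmn ih =>
    rw [ddiffPerm_schubTop_succ a (hm.mono hmn)]
    rcases Nat.eq_zero_or_pos n with rfl | h
    · obtain rfl : m = 0 := by omega
      rfl
    · exact ih h (hm.mono hmn)

theorem exists_memS_ge (u : SInf) (N : ℕ) : ∃ n, N < n ∧ MemS n u := by
  obtain ⟨n, -, hu⟩ := exists_memS u
  exact ⟨max n N + 1, by omega, hu.mono (by omega)⟩

theorem ddiff_schub_of_gt (a : ℕ → R) {u : SInf} {i : ℕ} (h : u.1 (i + 1) < u.1 i) :
    ddiff i (schub a u) = schub a (u * simpleRefl i) := by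
  obtain ⟨n, hn, hu⟩ := exists_memS_ge u i
  rw [schub_eq a (by omega) hu, schub_eq a (by omega) (hu.mul (memS_simpleRefl (by omega))),
    mul_inv_rev, simpleRefl_inv, mul_assoc, ddiffPerm_simpleRefl_mul]
  have e : (u⁻¹ * w0 n)⁻¹ = w0 n * u := by
    rw [mul_inv_rev, inv_inv, inv_eq_of_mul_eq_one_left (w0_mul_self n)]
  have := hu.apply_le (show i ≤ n by omega)
  rw [e, coe_mul_apply, coe_mul_apply, w0_apply_of_le this, w0_apply_of_le (by omega)]
  omega

theorem ddiff_schub_of_lt (a : ℕ → R) {u : SInf} {i : ℕ} (h : u.1 i < u.1 (i + 1)) :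
    ddiff i (schub a u) = 0 := by
  obtain ⟨n, hn, hu⟩ := exists_memS_ge u i
  rw [schub_eq a (by omega) hu, ddiff_ddiffPerm_eq_zero]
  have e : (u⁻¹ * w0 n)⁻¹ = w0 n * u := by
    rw [mul_inv_rev, inv_inv, inv_eq_of_mul_eq_one_left (w0_mul_self n)]
  have := hu.apply_le (show i + 1 ≤ n by omega)
  rw [e, coe_mul_apply, coe_mul_apply, w0_apply_of_le this, w0_apply_of_le (by omega)]
  omega

theorem ddiffPerm_schub (a : ℕ → R) (g w : SInf) : ddiffPerm g (schub a w) =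
    if len (w * g⁻¹) + len g = len w then schub a (w * g⁻¹) else 0 := by
  induction h : len g generalizing g with
  | zero =>
    obtain rfl : g = 1 := by
      by_contra hg
      obtain ⟨i, hi⟩ := exists_descent hg
      have := len_mul_simpleRefl_of_gt hi
      omega
    rw [ddiffPerm_one, inv_one, mul_one, if_pos (by omega)]
  | succ n ih =>
    have hg : g⁻¹ ≠ 1 := by
      intro hg
      rw [inv_eq_one] at hg
      rw [hg, len_one] at h
      omega
    obtain ⟨i, hi⟩ := exists_descent hg
    have hl := len_simpleRefl_mul_of_gt hi
    set g' := simpleRefl i * g with hg'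
    have e1 : g = simpleRefl i * g' := (simpleRefl_mul_simpleRefl_mul g i).symm
    have hi' : (g'⁻¹).1 i < (g'⁻¹).1 (i + 1) := by
      rwa [hg', simpleRefl_mul_inv, mul_simpleRefl_apply_self, mul_simpleRefl_apply_succ]
    have e2 : w * g⁻¹ = w * g'⁻¹ * simpleRefl i := by
      rw [e1, simpleRefl_mul_inv, mul_assoc]
    rw [e2, e1, ddiffPerm_simpleRefl_mul hi', ih g' (by omega)]
    have hsub := len_mul_le (w * g'⁻¹) g'
    rw [inv_mul_cancel_right] at hsub
    rcases lt_or_gt_of_ne (apply_ne_apply_succ (w * g'⁻¹) i) with hd | hd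
    · have := len_mul_simpleRefl_of_lt hd
      rw [if_neg (show ¬ _ + (n + 1) = _ by omega)]
      split_ifs
      · exact ddiff_schub_of_lt a hd
      · exact ddiff_zero i
    · have := len_mul_simpleRefl_of_gt hd
      by_cases hc : len (w * g'⁻¹) + n = len w
      · rw [if_pos hc, if_pos (by omega), ddiff_schub_of_gt a hd]
      · rw [if_neg hc, if_neg (by omega), ddiff_zero]

theorem code_eq_zero_of_memS {n : ℕ} {v : SInf} (hv : MemS n v) {i : ℕ} (hi : n ≤ i) :
    code v i = 0 := by
  have := code_le_of_memS hv i
  omega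

/-- The double Schubert polynomial of a dominant permutation is a product of linear factors, by
descent from the longest element: a dominant `v` other than `w_0(n)` is obtained by removing a cell
from the row `i` of the diagram of a dominant `v s_i`. -/
theorem schub_of_isDominant (a : ℕ → R) {n : ℕ} (hn : 0 < n) (v : SInf) (hv : MemS n v)
    (hd : IsDominant v) : schub a v = diagramProd a (n + 1) (code v) := by
  induction hm : (n + 1) * (n + 1) - len v using Nat.strong_induction_on generalizing v with
  | _ m ih =>
    by_cases hex : ∃ i, i < n ∧ v.1 i < v.1 (i + 1)
    · classical
      -- the least ascent keeps the code weakly decreasing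
      obtain ⟨hin, hlt⟩ := Nat.find_spec hex
      have hmin : ∀ j, j < Nat.find hex → v.1 (j + 1) < v.1 j := fun j hj => by
        have := Nat.find_min hex hj
        have := apply_ne_apply_succ v j
        omega
      generalize Nat.find hex = i at hin hlt hmin
      have hci : code v (i + 1) = code v i := le_antisymm (hd i) (code_le_code_succ_iff.2 hlt)
      have c1 := code_mul_simpleRefl_self hlt
      have c2 := code_mul_simpleRefl_succ hlt
      have c3 : ∀ j, j ≠ i → j ≠ i + 1 → code (v * simpleRefl i) j = code v j := fun j h1 h2 =>
        code_mul_simpleRefl_of_ne v h1 h2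
      have hv' : MemS n (v * simpleRefl i) := hv.mul (memS_simpleRefl (by omega))
      have hd' : IsDominant (v * simpleRefl i) := by
        intro j
        rcases lt_trichotomy (j + 1) i with hj | hj | hj
        · rw [c3 _ (by omega) (by omega), c3 _ (by omega) (by omega)]
          exact hd j
        · have := code_lt_of_gt (hmin j (by omega))
          rw [hj] at this ⊢
          rw [c1, c3 j (by omega) (by omega)]
          omega
        · rcases eq_or_ne j i with rfl | hji
          · omega
          · rcases eq_or_ne j (i + 1) with rfl | hji'
            · rw [c2, c3 _ (by omega) (by omega)]
              have := hd (i + 1)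
              omega
            · rw [c3 _ (by omega) (by omega), c3 _ (by omega) (by omega)]
              exact hd j
      have hl := len_mul_simpleRefl_of_lt hlt
      have hb := len_le_of_memS hv'
      have hs := ih _ (by omega) (v * simpleRefl i) hv' hd' rfl
      have hdd := ddiff_schub_of_gt a (u := v * simpleRefl i) (i := i) (by
        rwa [mul_simpleRefl_apply_self, mul_simpleRefl_apply_succ])
      rw [mul_simpleRefl_mul_simpleRefl, hs, ddiff_diagramProd (by omega) (by omega)] at hdd
      rw [← hdd]
      refine diagramProd_congr fun j _ => ?_
      rcases eq_or_ne j i with rfl | hji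
      · rw [Function.update_self, c2]
      · rw [Function.update_of_ne hji]
        rcases eq_or_ne j (i + 1) with rfl | hji'
        · rw [c2, hci]
        · exact c3 j hji hji'
    · push Not at hex
      obtain rfl := eq_w0_of_forall_gt hv fun i hi =>
        lt_of_le_of_ne (hex i hi) (apply_ne_apply_succ v i).symm
      rw [schub_eq a hn hv, inv_mul_cancel, ddiffPerm_one, schubTop_eq,
        ← diagramProd_mono (show n ≤ n + 1 by omega) fun i hi => by omega]
      exact diagramProd_congr fun i _ => (code_w0 n i).symm

/-- The variation of a double Schubert polynomial under a ring endomorphism `φ` that exchanges the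
secondary variables `a_i` and `a_{i+1}`. -/
theorem schub_sub_map (a : ℕ → R) (φ : R →+* R) (i : ℕ) (hφ : ∀ j, φ (a j) = a ((simpleRefl i).1 j))
    (w : SInf) : schub a w - map φ (schub a w) =
      if (w⁻¹).1 (i + 1) < (w⁻¹).1 i then C (a (i + 1) - a i) * schub a (simpleRefl i * w)
      else 0 := by
  obtain ⟨n, hn, hw⟩ := exists_memS_ge w i
  set k := n - 1 - i with hk
  set c' : ℕ → ℕ := Function.update (fun l => n - l) k i with hc'
  have htop : schubTop a n = (X k - C (a i)) * diagramProd a (n + 1) c' := by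
    rw [schubTop_eq, ← diagramProd_mono (show n ≤ n + 1 by omega) fun i hi => by omega]
    exact diagramProd_update (by omega) (by omega)
  have hdd : ddiff k (schubTop a n) = diagramProd a (n + 1) c' := by
    rw [schubTop_eq, ← diagramProd_mono (show n ≤ n + 1 by omega) fun i hi => by omega,
      ddiff_diagramProd (by omega) (by omega), hc']
    congr 2
    omega
  have hinv : map φ (diagramProd a (n + 1) c') = diagramProd a (n + 1) c' := by
    unfold diagramProd
    rw [map_prod]
    refine Finset.prod_congr rfl fun l _ => ?_
    rw [map_prod]
    have hs := simpleRefl_apply_apply i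
    have hcl : c' l ≤ i ∨ i + 2 ≤ c' l := by
      rcases eq_or_ne l k with rfl | hl
      · rw [hc', Function.update_self]; omega
      · rw [hc', Function.update_of_ne hl]; omega
    have hr : ∀ j ∈ Finset.range (c' l), (simpleRefl i).1 j ∈ Finset.range (c' l) := fun j hj => by
      rw [Finset.mem_range] at hj ⊢
      rw [coe_simpleRefl_apply]
      split_ifs <;> omega
    refine Finset.prod_nbij' (simpleRefl i).1 (simpleRefl i).1 hr hr (fun j _ => hs j)
      (fun j _ => hs j) fun j _ => ?_
    rw [map_sub, map_X, map_C, hφ]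
  have hdiff : schubTop a n - map φ (schubTop a n) =
      C (a (i + 1) - a i) * ddiff k (schubTop a n) := by
    rw [hdd, htop, map_mul, hinv, map_sub, map_X, map_C, hφ, coe_simpleRefl_apply, if_pos rfl,
      C_sub]
    ring
  set g := w⁻¹ * w0 n with hg
  have hsub : ∀ P Q : MvPolynomial ℕ R, ddiffPerm g P - ddiffPerm g Q = ddiffPerm g (P - Q) :=
    fun P Q => by rw [sub_eq_iff_eq_add, ← ddiffPerm_add, sub_add_cancel]
  have g1 : g.1 k = (w⁻¹).1 (i + 1) := by
    rw [hg, coe_mul_apply, w0_apply_of_le (by omega)]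
    congr 1
    omega
  have g2 : g.1 (k + 1) = (w⁻¹).1 i := by
    rw [hg, coe_mul_apply, w0_apply_of_le (by omega)]
    congr 1
    omega
  rw [schub_eq a (by omega) hw, map_ddiffPerm, hsub, hdiff, ddiffPerm_C_mul]
  split_ifs with h
  · rw [schub_eq a (by omega) ((memS_simpleRefl (by omega)).mul hw), simpleRefl_mul_inv, mul_assoc,
      simpleRefl_mul_w0 (by omega), ← mul_assoc, ← hg, ← hk, ddiffPerm_mul_simpleRefl (by omega)]
  · have := apply_ne_apply_succ w⁻¹ i
    rw [ddiffPerm_ddiff_eq_zero (by omega), mul_zero]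

end Schubert

/-! ### Chains in the Bruhat order -/

/-- `KChain k u A w`: there is a saturated chain from `u` to `w` of the kind that defines `KStep`,
and `A` is the set of the positions `a_i` that occur in it. -/
inductive KChain (k : ℕ) (u : SInf) : Finset ℕ → SInf → Prop
  | refl : KChain k u ∅ u
  | step {A : Finset ℕ} {v : SInf} {a b : ℕ} (h : KChain k u A v) (ha : a ∉ A) (hak : a < k)
      (hkb : k ≤ b) (hc : Cover v a b) : KChain k u (insert a A) (v * transp a b)

theorem transProd_append (L L' : List (ℕ × ℕ)) :
    transProd (L ++ L') = transProd L * transProd L' := by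
  simp [transProd]

theorem transProd_singleton (p : ℕ × ℕ) : transProd [p] = transp p.1 p.2 := by
  simp [transProd]

theorem KChain.of_list {k : ℕ} {u : SInf} (L : List (ℕ × ℕ)) (h1 : ∀ p ∈ L, p.1 < k ∧ k ≤ p.2)
    (h2 : (L.map Prod.fst).Nodup)
    (h3 : ∀ i ≤ L.length, len (u * transProd (L.take i)) = len u + i) :
    KChain k u (L.map Prod.fst).toFinset (u * transProd L) := by
  induction L using List.reverseRecOn with
  | nil => exact KChain.refl
  | append_singleton L p ih =>
    have hp := h1 p (by simp)
    rw [List.map_append, List.nodup_append] at h2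
    have hL : KChain k u (L.map Prod.fst).toFinset (u * transProd L) :=
      ih (fun q hq => h1 q (by simp [hq])) h2.1 fun i hi => by
        have := h3 i (by simp; omega)
        rwa [List.take_append_of_le_length hi] at this
    have l1 := h3 L.length (by simp)
    have l2 := h3 (L.length + 1) (by simp)
    rw [List.take_append_of_le_length le_rfl, List.take_length] at l1
    rw [List.take_of_length_le (by simp), transProd_append, transProd_singleton, ← mul_assoc] at l2
    have hcov : Cover (u * transProd L) p.1 p.2 := (cover_iff (by omega)).2 (by omega)
    have hn : p.1 ∉ (L.map Prod.fst).toFinset := by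
      intro hm
      rw [List.mem_toFinset] at hm
      exact h2.2.2 p.1 hm p.1 (by simp) rfl
    have := hL.step hn hp.1 hp.2 hcov
    rw [transProd_append, transProd_singleton, ← mul_assoc]
    convert this using 1
    ext x
    simp

theorem KChain.exists_list {k : ℕ} {u w : SInf} {A : Finset ℕ} (h : KChain k u A w) :
    ∃ L : List (ℕ × ℕ), (∀ p ∈ L, p.1 < k ∧ k ≤ p.2) ∧ (L.map Prod.fst).Nodup ∧
      (L.map Prod.fst).toFinset = A ∧
      (∀ i ≤ L.length, len (u * transProd (L.take i)) = len u + i) ∧ w = u * transProd L := by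
  induction h with
  | refl => exact ⟨[], by simp, by simp, by simp, by simp [transProd], by simp [transProd]⟩
  | @step A v a b _ ha hak hkb hc ih =>
    obtain ⟨L, h1, h2, h3, h4, h5⟩ := ih
    have ha' : a ∉ L.map Prod.fst := by
      rwa [← List.mem_toFinset, h3]
    refine ⟨L ++ [(a, b)], ?_, ?_, ?_, ?_, ?_⟩
    · intro p hp
      rw [List.mem_append, List.mem_singleton] at hp
      rcases hp with hp | rfl
      · exact h1 p hp
      · exact ⟨hak, hkb⟩
    · rw [List.map_append, List.nodup_append]
      refine ⟨h2, by simp, fun x hx y hy => ?_⟩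
      rintro rfl
      simp only [List.map_cons, List.map_nil, List.mem_singleton] at hy
      exact ha' (hy ▸ hx)
    · ext x
      rw [← h3]
      simp
    · intro i hi
      rcases Nat.lt_or_ge L.length i with hlt | hle
      · have hi' : i = L.length + 1 := by
          simp at hi
          omega
        rw [List.take_of_length_le (by simp; omega), transProd_append, transProd_singleton,
          ← mul_assoc, ← h5, (cover_iff (by omega)).1 hc, h5]
        have := h4 L.length le_rfl
        rw [List.take_length] at this
        omega
      · rw [List.take_append_of_le_length hle]
        exact h4 i hle
    · rw [transProd_append, transProd_singleton, ← mul_assoc, ← h5]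

theorem KChain.subset {k : ℕ} {u w : SInf} {A : Finset ℕ} (h : KChain k u A w) :
    A ⊆ Finset.range k := by
  induction h with
  | refl => simp
  | step _ _ hak _ _ ih =>
    rw [Finset.insert_subset_iff, Finset.mem_range]
    exact ⟨hak, ih⟩

theorem kStep_iff {k : ℕ} {u w : SInf} : KStep k u w ↔ ∃ A, KChain k u A w := by
  constructor
  · rintro ⟨L, -, h1, h2, h3, rfl⟩
    exact ⟨_, KChain.of_list L h1 h2 h3⟩
  · rintro ⟨A, h⟩
    obtain ⟨L, h1, h2, h3, h4, h5⟩ := h.exists_list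
    refine ⟨L, ?_, h1, h2, h4, h5⟩
    have := Finset.card_le_card h.subset
    rw [← h3, List.toFinset_card_of_nodup h2, List.length_map, Finset.card_range] at this
    exact this

theorem KChain.apply_of_notMem {k : ℕ} {u w : SInf} {A : Finset ℕ} (h : KChain k u A w) {c : ℕ}
    (hc : c < k) (hcA : c ∉ A) : w.1 c = u.1 c := by
  induction h with
  | refl => rfl
  | step _ _ hak hkb _ ih =>
    rw [Finset.mem_insert, not_or] at hcA
    rw [mul_transp_apply, if_neg hcA.1, if_neg (by omega), ih hcA.2]

theorem KChain.lt_apply_of_mem {k : ℕ} {u w : SInf} {A : Finset ℕ} (h : KChain k u A w) {c : ℕ}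
    (hcA : c ∈ A) : u.1 c < w.1 c := by
  induction h with
  | refl => simp at hcA
  | @step A v a b h ha hak hkb hcov ih =>
    have hck : c < k := by
      rcases Finset.mem_insert.1 hcA with rfl | hc
      · exact hak
      · exact Finset.mem_range.1 (h.subset hc)
    rw [mul_transp_apply]
    split_ifs with h1 h2
    · rw [h1, ← h.apply_of_notMem hak ha]
      exact hcov.1
    · omega
    · exact ih ((Finset.mem_insert.1 hcA).resolve_left h1)

theorem KChain.le_apply {k : ℕ} {u w : SInf} {A : Finset ℕ} (h : KChain k u A w) {c : ℕ}
    (hc : c < k) : u.1 c ≤ w.1 c := by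
  by_cases hcA : c ∈ A
  · exact (h.lt_apply_of_mem hcA).le
  · exact (h.apply_of_notMem hc hcA).ge

theorem KChain.mem_iff {k : ℕ} {u w : SInf} {A : Finset ℕ} (h : KChain k u A w) {c : ℕ}
    (hc : c < k) : c ∈ A ↔ u.1 c ≠ w.1 c := by
  constructor
  · intro hcA
    exact (h.lt_apply_of_mem hcA).ne
  · intro hne
    by_contra hcA
    exact hne (h.apply_of_notMem hc hcA).symm

theorem KChain.memS {k n : ℕ} {u w : SInf} {A : Finset ℕ} (h : KChain k u A w) (hu : MemS n u)
    (hk : k ≤ n) : MemS (n + A.card) w := by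
  induction h with
  | refl => exact hu
  | @step A v a b h ha hak hkb hcov ih =>
    rw [Finset.card_insert_of_notMem ha, ← add_assoc]
    have hb : b ≤ n + A.card + 1 := by
      by_contra hb
      refine hcov.2 (n + A.card + 1) (by omega) (by omega) ⟨?_, ?_⟩
      · rw [ih (n + A.card + 1) (by omega)]
        have := ih.apply_le (i := a) (by omega)
        omega
      · rw [ih (n + A.card + 1) (by omega), ih b (by omega)]
        omega
    exact (ih.mono (by omega)).mul (memS_transp (by omega) hb)

theorem finite_kStep (k : ℕ) (u : SInf) : {w | KStep k u w}.Finite := by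
  obtain ⟨n, hn, hu⟩ := exists_memS_ge u k
  refine (finite_memS (n + k)).subset fun w hw => ?_
  obtain ⟨A, hA⟩ := kStep_iff.1 hw
  have := Finset.card_le_card hA.subset
  rw [Finset.card_range] at this
  exact (hA.memS hu hn.le).mono (by omega)

/-! ### Chains and multiplication on the right -/

theorem Cover.ascent {k i a b : ℕ} {v : SInf} (h : Cover v a b) (hak : a < k) (hkb : k ≤ b)
    (hi : i + 1 ≠ k) (hv : v.1 i < v.1 (i + 1)) :
    (v * transp a b).1 i < (v * transp a b).1 (i + 1) := by
  have h0 := h.1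
  have h1 := h.2 i
  have h2 := h.2 (i + 1)
  have hinj := v.1.injective.eq_iff (a := i) (b := a)
  have hinj' := v.1.injective.eq_iff (a := i + 1) (b := b)
  rw [mul_transp_apply, mul_transp_apply]
  split_ifs <;> subst_vars <;> omega

theorem KChain.ascent {k i : ℕ} {u w : SInf} {A : Finset ℕ} (h : KChain k u A w)
    (hi : i + 1 ≠ k) (hu : u.1 i < u.1 (i + 1)) : w.1 i < w.1 (i + 1) := by
  induction h with
  | refl => exact hu
  | step _ _ hak hkb hcov ih => exact hcov.ascent hak hkb hi ih

theorem mul_transp_mul_simpleRefl (v : SInf) (a b i : ℕ) :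
    v * transp a b * simpleRefl i =
      v * simpleRefl i * transp ((simpleRefl i).1 a) ((simpleRefl i).1 b) := by
  have h : transp a b * simpleRefl i =
      simpleRefl i * transp ((simpleRefl i).1 a) ((simpleRefl i).1 b) := by
    have := Equiv.swap_mul_eq_mul_swap (simpleRefl i).1 a b
    have e : (simpleRefl i).1⁻¹ = (simpleRefl i).1 := congrArg Subtype.val (simpleRefl_inv i)
    rw [e] at this
    exact Subtype.ext this
  rw [mul_assoc, h, mul_assoc]

theorem simpleRefl_apply_lt_iff {k i a : ℕ} (hi : i + 1 ≠ k) : (simpleRefl i).1 a < k ↔ a < k := by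
  rw [coe_simpleRefl_apply]
  split_ifs <;> omega

/-- A step of a chain conjugated by `s_i`, as long as the lengths change alike. -/
theorem KChain.step_simpleRefl {k i a b : ℕ} {u v : SInf} {A : Finset ℕ} (hi : i + 1 ≠ k)
    (h : KChain k (u * simpleRefl i) (A.image (simpleRefl i).1) (v * simpleRefl i))
    (ha : a ∉ A) (hak : a < k) (hkb : k ≤ b)
    (hl : len (v * transp a b * simpleRefl i) = len (v * simpleRefl i) + 1) :
    KChain k (u * simpleRefl i) ((insert a A).image (simpleRefl i).1)
      (v * transp a b * simpleRefl i) := by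
  have h1 := (simpleRefl_apply_lt_iff (a := a) hi).2 hak
  have h2 : k ≤ (simpleRefl i).1 b := by
    have := simpleRefl_apply_lt_iff (a := b) hi
    omega
  rw [Finset.image_insert]
  rw [mul_transp_mul_simpleRefl] at hl ⊢
  refine h.step ?_ h1 h2 ((cover_iff (by omega)).2 hl)
  rw [Finset.mem_image]
  rintro ⟨c, hc, he⟩
  exact ha ((simpleRefl i).1.injective he ▸ hc)

theorem KChain.mul_simpleRefl_of_lt {k i : ℕ} {u w : SInf} {A : Finset ℕ} (h : KChain k u A w)
    (hi : i + 1 ≠ k) (hu : u.1 i < u.1 (i + 1)) :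
    KChain k (u * simpleRefl i) (A.image (simpleRefl i).1) (w * simpleRefl i) := by
  induction h with
  | refl => exact KChain.refl
  | step h ha hak hkb hcov ih =>
    refine ih.step_simpleRefl hi ha hak hkb ?_
    have hv := h.ascent hi hu
    rw [len_mul_simpleRefl_of_lt hv, len_mul_simpleRefl_of_lt (hcov.ascent hak hkb hi hv),
      (cover_iff (by omega)).1 hcov]

theorem KChain.mul_simpleRefl_of_gt {k i : ℕ} {u w : SInf} {A : Finset ℕ} (h : KChain k u A w)
    (hi : i + 1 ≠ k) (hw : w.1 (i + 1) < w.1 i) :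
    KChain k (u * simpleRefl i) (A.image (simpleRefl i).1) (w * simpleRefl i) := by
  induction h with
  | refl => exact KChain.refl
  | @step A v a b h ha hak hkb hcov ih =>
    have hv : v.1 (i + 1) < v.1 i := by
      by_contra hc
      have := hcov.ascent hak hkb hi (lt_of_le_of_ne (not_lt.1 hc) (apply_ne_apply_succ v i))
      omega
    refine (ih hv).step_simpleRefl hi ha hak hkb ?_
    have l1 := len_mul_simpleRefl_of_gt hv
    have l2 := len_mul_simpleRefl_of_gt hw
    have l3 := (cover_iff (by omega)).1 hcov
    omega

theorem kStep_mul_simpleRefl_iff {k i : ℕ} {u w : SInf} (hi : i + 1 ≠ k)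
    (hu : u.1 (i + 1) < u.1 i) :
    KStep k (u * simpleRefl i) w ↔ w.1 i < w.1 (i + 1) ∧ KStep k u (w * simpleRefl i) := by
  rw [kStep_iff, kStep_iff]
  constructor
  · rintro ⟨A, hA⟩
    have hu' : (u * simpleRefl i).1 i < (u * simpleRefl i).1 (i + 1) := by
      rwa [mul_simpleRefl_apply_self, mul_simpleRefl_apply_succ]
    refine ⟨hA.ascent hi hu', A.image (simpleRefl i).1, ?_⟩
    have := hA.mul_simpleRefl_of_lt hi hu'
    rwa [mul_simpleRefl_mul_simpleRefl] at this
  · rintro ⟨hw, A, hA⟩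
    refine ⟨A.image (simpleRefl i).1, ?_⟩
    have := hA.mul_simpleRefl_of_gt hi (by
      rwa [mul_simpleRefl_apply_self, mul_simpleRefl_apply_succ])
    rwa [mul_simpleRefl_mul_simpleRefl] at this

theorem mem_fixedValues {k : ℕ} {u w : SInf} {q : ℕ} :
    q ∈ fixedValues k u w ↔ ∃ j < k, u.1 j = w.1 j ∧ u.1 j = q := by
  simp [fixedValues, and_assoc]

theorem fixedValues_mul_simpleRefl {k i : ℕ} (u w : SInf) (hi : i + 1 ≠ k) :
    fixedValues k (u * simpleRefl i) w = fixedValues k u (w * simpleRefl i) := by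
  have hs := simpleRefl_apply_apply i
  ext q
  simp only [mem_fixedValues, coe_mul_apply]
  constructor
  · rintro ⟨j, h1, h2, rfl⟩
    exact ⟨_, (simpleRefl_apply_lt_iff hi).2 h1, by rw [h2, hs], rfl⟩
  · rintro ⟨j, h1, h2, rfl⟩
    exact ⟨_, (simpleRefl_apply_lt_iff hi).2 h1, by rw [hs, h2], by rw [hs]⟩

/-! ### Chains and multiplication on the left -/

theorem mul_transp_inv (v : SInf) (a b : ℕ) : (v * transp a b)⁻¹ = transp a b * v⁻¹ := by
  rw [mul_inv_rev, inv_eq_of_mul_eq_one_left (transp_mul_self a b)]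

/-- If the value `i` stands before `i + 1`, then so it does after a covering step, unless the step
exchanges these two values. -/
theorem Cover.inv_ascent {i c d : ℕ} {v : SInf} (h : Cover v c d) (hcd : c < d)
    (hv : (v⁻¹).1 i < (v⁻¹).1 (i + 1)) (hne : ¬ (v.1 c = i ∧ v.1 d = i + 1)) :
    ((v * transp c d)⁻¹).1 i < ((v * transp c d)⁻¹).1 (i + 1) := by
  rw [mul_transp_inv, coe_mul_apply, coe_mul_apply, coe_transp_apply, coe_transp_apply]
  obtain ⟨p, hp⟩ : ∃ p, p = (v⁻¹).1 i := ⟨_, rfl⟩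
  obtain ⟨q, hq⟩ : ∃ q, q = (v⁻¹).1 (i + 1) := ⟨_, rfl⟩
  have hp' : v.1 p = i := by rw [hp, apply_inv_self']
  have hq' : v.1 q = i + 1 := by rw [hq, apply_inv_self']
  rw [← hp, ← hq] at hv ⊢
  have h0 := h.1
  have h1 := h.2 p
  have h2 := h.2 q
  have i1 := v.1.injective.eq_iff (a := p) (b := c)
  have i2 := v.1.injective.eq_iff (a := p) (b := d)
  have i3 := v.1.injective.eq_iff (a := q) (b := c)
  have i4 := v.1.injective.eq_iff (a := q) (b := d)
  split_ifs <;> omega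

theorem KChain.step_left {k i c d : ℕ} {u v : SInf} {A : Finset ℕ} (h : KChain k u A (simpleRefl i * v))
    (hc : c ∉ A) (hck : c < k) (hkd : k ≤ d)
    (hl : len (simpleRefl i * (v * transp c d)) = len (simpleRefl i * v) + 1) :
    KChain k u (insert c A) (simpleRefl i * (v * transp c d)) := by
  rw [← mul_assoc] at hl ⊢
  exact h.step hc hck hkd ((cover_iff (by omega)).2 hl)

theorem simpleRefl_mul_eq_mul_transp {v : SInf} {i c d : ℕ} (hc : v.1 c = i) (hd : v.1 d = i + 1) :
    v * transp c d = simpleRefl i * v := by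
  refine SInf.ext_apply fun j => ?_
  rw [mul_transp_apply, coe_mul_apply, coe_simpleRefl_apply, hc, hd]
  have i1 := v.1.injective.eq_iff (a := j) (b := c)
  have i2 := v.1.injective.eq_iff (a := j) (b := d)
  split_ifs <;> omega

section Left

variable {k i a b : ℕ} {u : SInf}

theorem simpleRefl_mul_apply_left (ha : u.1 a = i + 1) : (simpleRefl i * u).1 a = i := by
  rw [coe_mul_apply, ha, coe_simpleRefl_apply, if_neg (by omega), if_pos rfl]

theorem simpleRefl_mul_apply_right (hb : u.1 b = i) : (simpleRefl i * u).1 b = i + 1 := by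
  rw [coe_mul_apply, hb, coe_simpleRefl_apply, if_pos rfl]

theorem simpleRefl_mul_inv_lt (ha : u.1 a = i + 1) (hb : u.1 b = i) (hab : a < b) :
    ((simpleRefl i * u)⁻¹).1 i < ((simpleRefl i * u)⁻¹).1 (i + 1) := by
  have e1 : (u⁻¹).1 (i + 1) = a := by rw [← ha, inv_apply_self']
  have e2 : (u⁻¹).1 i = b := by rw [← hb, inv_apply_self']
  rw [simpleRefl_mul_inv, mul_simpleRefl_apply_self, mul_simpleRefl_apply_succ, e1, e2]
  exact hab

/-- A chain that starts at `s_i u` and never exchanges the values `i` and `i + 1` is carried by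
left multiplication with `s_i` to a chain that starts at `u`. -/
theorem KChain.left_of_apply_ne (ha : u.1 a = i + 1) (hb : u.1 b = i) (hak : a < k) (hkb : k ≤ b)
    {A : Finset ℕ} {v : SInf} (h : KChain k (simpleRefl i * u) A v) (hv : v.1 a ≠ i + 1) :
    (v⁻¹).1 i < (v⁻¹).1 (i + 1) ∧ KChain k u A (simpleRefl i * v) := by
  induction h with
  | refl =>
    refine ⟨simpleRefl_mul_inv_lt ha hb (by omega), ?_⟩
    rw [simpleRefl_mul_simpleRefl_mul]
    exact KChain.refl
  | @step A v c d h hc hck hkd hcov ih =>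
    have hva : v.1 a ≠ i + 1 := by
      rw [mul_transp_apply] at hv
      split_ifs at hv with h1 h2
      · rw [h1, h.apply_of_notMem hck hc, ← h1, simpleRefl_mul_apply_left ha]
        omega
      · omega
      · exact hv
    obtain ⟨h1, h2⟩ := ih hva
    have hne : ¬ (v.1 c = i ∧ v.1 d = i + 1) := by
      rintro ⟨e1, e2⟩
      rw [h.apply_of_notMem hck hc] at e1
      obtain rfl : c = a := (simpleRefl i * u).1.injective
        (e1.trans (simpleRefl_mul_apply_left ha).symm)
      rw [mul_transp_apply, if_pos rfl] at hv
      exact hv e2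
    have h3 := hcov.inv_ascent (by omega) h1 hne
    refine ⟨h3, h2.step_left hc hck hkd ?_⟩
    rw [len_simpleRefl_mul_of_lt h1, len_simpleRefl_mul_of_lt h3, (cover_iff (by omega)).1 hcov]

theorem KChain.left_of_inv_gt (hb : u.1 b = i) (hkb : k ≤ b)
    {A : Finset ℕ} {v : SInf} (h : KChain k u A v) (hv : (v⁻¹).1 (i + 1) < (v⁻¹).1 i) :
    KChain k (simpleRefl i * u) A (simpleRefl i * v) := by
  induction h with
  | refl => exact KChain.refl
  | @step A v c d h hc hck hkd hcov ih =>
    have h1 : (v⁻¹).1 (i + 1) < (v⁻¹).1 i := by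
      by_contra hn
      have hne : ¬ (v.1 c = i ∧ v.1 d = i + 1) := by
        rintro ⟨e1, -⟩
        rw [h.apply_of_notMem hck hc] at e1
        have := u.1.injective (e1.trans hb.symm)
        omega
      have := hcov.inv_ascent (by omega)
        (lt_of_le_of_ne (not_lt.1 hn) (apply_ne_apply_succ v⁻¹ i)) hne
      omega
    refine (ih h1).step_left hc hck hkd ?_
    have l1 := len_simpleRefl_mul_of_gt h1
    have l2 := len_simpleRefl_mul_of_gt hv
    have l3 := (cover_iff (by omega)).1 hcov
    omega

/-- In a chain from `s_i u` that takes the value at `a` from `i` to `i + 1`, the step that does so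
can be left out if the chain is started at `u`. -/
theorem KChain.left_of_apply_eq (ha : u.1 a = i + 1) (hb : u.1 b = i) (hak : a < k) (hkb : k ≤ b)
    {A : Finset ℕ} {v : SInf} (h : KChain k (simpleRefl i * u) A v) (hv : v.1 a = i + 1) :
    KChain k u (A.erase a) v := by
  induction h with
  | refl =>
    rw [simpleRefl_mul_apply_left ha] at hv
    omega
  | @step A v c d h hc hck hkd hcov ih =>
    rw [mul_transp_apply] at hv
    split_ifs at hv with h1 h2
    · subst h1
      have hva : v.1 a = i := by rw [h.apply_of_notMem hck hc, simpleRefl_mul_apply_left ha]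
      rw [Finset.erase_insert hc, simpleRefl_mul_eq_mul_transp hva hv]
      exact (h.left_of_apply_ne ha hb hak hkb (by omega)).2
    · omega
    · rw [Finset.erase_insert_of_ne (Ne.symm h1)]
      exact (ih hv).step (fun hm => hc (Finset.mem_of_mem_erase hm)) hck hkd hcov

theorem KChain.left_cons (ha : u.1 a = i + 1) (hb : u.1 b = i) (hak : a < k) (hkb : k ≤ b)
    {A : Finset ℕ} {v : SInf} (h : KChain k u A v) (haA : a ∉ A) :
    KChain k (simpleRefl i * u) (insert a A) v := by
  induction h with
  | refl =>
    have e1 := simpleRefl_mul_apply_left ha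
    have e2 := simpleRefl_mul_apply_right hb
    have := KChain.refl.step (k := k) (u := simpleRefl i * u) (Finset.notMem_empty a) hak hkb
      ⟨by omega, fun c _ _ => by omega⟩
    rwa [simpleRefl_mul_eq_mul_transp e1 e2, simpleRefl_mul_simpleRefl_mul] at this
  | @step A v c d h hc hck hkd hcov ih =>
    rw [Finset.mem_insert, not_or] at haA
    rw [Finset.insert_comm]
    refine (ih haA.2).step ?_ hck hkd hcov
    rw [Finset.mem_insert, not_or]
    exact ⟨Ne.symm haA.1, hc⟩

theorem kStep_left_iff_of_ne (ha : u.1 a = i + 1) (hb : u.1 b = i) (hak : a < k) (hkb : k ≤ b)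
    {w : SInf} (hw : w.1 a ≠ i + 1) : KStep k (simpleRefl i * u) w ↔
      (w⁻¹).1 i < (w⁻¹).1 (i + 1) ∧ KStep k u (simpleRefl i * w) := by
  rw [kStep_iff, kStep_iff]
  constructor
  · rintro ⟨A, hA⟩
    obtain ⟨h1, h2⟩ := hA.left_of_apply_ne ha hb hak hkb hw
    exact ⟨h1, A, h2⟩
  · rintro ⟨h1, A, hA⟩
    refine ⟨A, ?_⟩
    have := hA.left_of_inv_gt hb hkb (by
      rwa [simpleRefl_mul_inv, mul_simpleRefl_apply_self, mul_simpleRefl_apply_succ])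
    rwa [simpleRefl_mul_simpleRefl_mul] at this

theorem kStep_left_iff_of_eq (ha : u.1 a = i + 1) (hb : u.1 b = i) (hak : a < k) (hkb : k ≤ b)
    {w : SInf} (hw : w.1 a = i + 1) : KStep k (simpleRefl i * u) w ↔ KStep k u w := by
  rw [kStep_iff, kStep_iff]
  constructor
  · rintro ⟨A, hA⟩
    exact ⟨_, hA.left_of_apply_eq ha hb hak hkb hw⟩
  · rintro ⟨A, hA⟩
    refine ⟨_, hA.left_cons ha hb hak hkb ?_⟩
    rw [hA.mem_iff hak, ha, hw]
    exact fun h => h rfl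

theorem not_kStep_of_apply_eq (ha : u.1 a = i + 1) (hak : a < k) {w : SInf} (hw : w.1 a = i + 1) :
    ¬ KStep k u (simpleRefl i * w) := by
  rw [kStep_iff]
  rintro ⟨A, hA⟩
  have := hA.le_apply hak
  rw [ha, simpleRefl_mul_apply_left hw] at this
  omega

end Left

/-! ### The Pieri formula -/

/-- The factorial elementary polynomial `∏_{i ≤ k} (x_i - z_j)`. -/
noncomputable def elemProd (k j : ℕ) : MvPolynomial ℕ CoeffRing :=
  ∏ i ∈ Finset.range k, (X i - C (varZ j))

open Classical in
/-- The coefficient of `𝔖_w` in the Pieri formula for `∏_{i ≤ k} (x_i - z_j) · 𝔖_u`. -/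
noncomputable def stepCoeff (k j : ℕ) (u w : SInf) : CoeffRing :=
  if KStep k u w then stepWeight k u w j else 0

/-- The Pieri formula for `∏_{i ≤ k} (x_i - z_j) · 𝔖_u`. -/
def PieriAt (k j : ℕ) (u : SInf) : Prop :=
  elemProd k j * schub varY u = ∑ᶠ w : SInf, C (stepCoeff k j u w) * schub varY w

theorem finite_support_of_stepCoeff (k j : ℕ) (u : SInf) {M : Type*} [AddMonoid M] (f : SInf → M)
    (hf : ∀ w, stepCoeff k j u w = 0 → f w = 0) : (Function.support f).Finite := by
  refine (finite_kStep k u).subset fun w hw => ?_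
  by_contra hc
  exact hw (hf w (if_neg hc))

theorem stepCoeff_congr {k j : ℕ} {u w u' w' : SInf} (h : KStep k u w ↔ KStep k u' w')
    (hF : fixedValues k u w = fixedValues k u' w') : stepCoeff k j u w = stepCoeff k j u' w' := by
  classical
  unfold stepCoeff stepWeight
  rw [hF]
  exact if_congr h rfl rfl

theorem act_elemProd {k i : ℕ} (j : ℕ) (hi : i + 1 ≠ k) :
    act (simpleRefl i) (elemProd k j) = elemProd k j := by
  unfold elemProd
  rw [act_prod]
  have hs := simpleRefl_apply_apply i
  have hr : ∀ l ∈ Finset.range k, (simpleRefl i).1 l ∈ Finset.range k := fun l hl => by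
    rw [Finset.mem_range] at hl ⊢
    exact (simpleRefl_apply_lt_iff hi).2 hl
  refine Finset.prod_nbij' (simpleRefl i).1 (simpleRefl i).1 hr hr (fun l _ => hs l)
    (fun l _ => hs l) fun l _ => ?_
  rw [act_sub, act_X, act_C]

/-- The divided difference as an additive homomorphism. -/
noncomputable def ddiffHom (i : ℕ) : MvPolynomial ℕ CoeffRing →+ MvPolynomial ℕ CoeffRing :=
  AddMonoidHom.mk' (ddiff i) (ddiff_add i)

/-- The Pieri formula for `u` implies that for `u s_i < u`, `i ≠ k`, by applying `∂_i`. -/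
theorem PieriAt.mul_simpleRefl {k j i : ℕ} {u : SInf} (h : PieriAt k j u) (hi : i + 1 ≠ k)
    (hu : u.1 (i + 1) < u.1 i) : PieriAt k j (u * simpleRefl i) := by
  have h1 := congrArg (ddiffHom i) h
  rw [AddMonoidHom.map_finsum _ (finite_support_of_stepCoeff k j u _ fun w hw => by
    rw [hw, C_0, zero_mul])] at h1
  change ddiff i _ = ∑ᶠ w, ddiff i _ at h1
  rw [ddiff_mul_of_act_eq (act_elemProd j hi), ddiff_schub_of_gt _ hu,
    ← finsum_comp_equiv (Equiv.mulRight (simpleRefl i))] at h1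
  refine h1.trans (finsum_congr fun w => ?_)
  rw [Equiv.coe_mulRight, ddiff_C_mul]
  by_cases hw : w.1 i < w.1 (i + 1)
  · rw [ddiff_schub_of_gt _ (by rwa [mul_simpleRefl_apply_self, mul_simpleRefl_apply_succ]),
      mul_simpleRefl_mul_simpleRefl]
    congr 2
    exact (stepCoeff_congr (by rw [kStep_mul_simpleRefl_iff hi hu, and_iff_right hw])
      (fixedValues_mul_simpleRefl u w hi)).symm
  · have hw' : w.1 (i + 1) < w.1 i := lt_of_le_of_ne (not_lt.1 hw) (apply_ne_apply_succ w i).symm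
    rw [ddiff_schub_of_lt _ (by rwa [mul_simpleRefl_apply_self, mul_simpleRefl_apply_succ]),
      mul_zero, stepCoeff, if_neg (by rw [kStep_mul_simpleRefl_iff hi hu]; exact fun h => hw h.1),
      C_0, zero_mul]

/-- The automorphism of the coefficient ring that exchanges `y_i` and `y_{i+1}`. -/
noncomputable def swapY (i : ℕ) : CoeffRing →+* CoeffRing :=
  (rename (Sum.map (simpleRefl i).1 id) : CoeffRing →ₐ[ℤ] CoeffRing)

theorem swapY_varY (i q : ℕ) : swapY i (varY q) = varY ((simpleRefl i).1 q) := rename_X _ _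

theorem swapY_varZ (i j : ℕ) : swapY i (varZ j) = varZ j := rename_X _ _

theorem map_swapY_elemProd (i k j : ℕ) : map (swapY i) (elemProd k j) = elemProd k j := by
  unfold elemProd
  rw [map_prod]
  refine Finset.prod_congr rfl fun l _ => ?_
  rw [map_sub, map_X, map_C, swapY_varZ]

theorem swapY_prod (i j : ℕ) (F : Finset ℕ) : swapY i (∏ q ∈ F, (varY q - varZ j)) =
    ∏ q ∈ F.image (simpleRefl i).1, (varY q - varZ j) := by
  rw [map_prod, Finset.prod_image fun x _ y _ h => (simpleRefl i).1.injective h]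
  refine Finset.prod_congr rfl fun q _ => ?_
  rw [map_sub, swapY_varY, swapY_varZ]

theorem image_simpleRefl_of_notMem {i : ℕ} {F : Finset ℕ} (h1 : i ∉ F) (h2 : i + 1 ∉ F) :
    F.image (simpleRefl i).1 = F := by
  have h : ∀ q ∈ F, (simpleRefl i).1 q = q := fun q hq => by
    rw [coe_simpleRefl_apply, if_neg (ne_of_mem_of_not_mem hq h1),
      if_neg (ne_of_mem_of_not_mem hq h2)]
  conv_rhs => rw [← Finset.image_id (s := F)]
  exact Finset.image_congr h

theorem fixedValues_simpleRefl_mul (k i : ℕ) (u w : SInf) : fixedValues k (simpleRefl i * u) w =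
    (fixedValues k u (simpleRefl i * w)).image (simpleRefl i).1 := by
  have hs := simpleRefl_apply_apply i
  ext q
  simp only [Finset.mem_image, mem_fixedValues, coe_mul_apply]
  constructor
  · rintro ⟨l, h1, h2, rfl⟩
    exact ⟨_, ⟨l, h1, by rw [← h2, hs], rfl⟩, rfl⟩
  · rintro ⟨_, ⟨l, h1, h2, rfl⟩, rfl⟩
    exact ⟨l, h1, by rw [h2, hs], rfl⟩

theorem finsum_sub_map_finsum {I B : Type*} [CommRing B] (τ : B →+* B) (e : I ≃ I)
    {c c' S : I → B} {D : B} (hc : (Function.support c).Finite) (hc' : (Function.support c').Finite)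
    (h : ∀ w, (c w - τ (c w)) * S w + τ (c (e w)) * (S (e w) - τ (S (e w))) = D * (c' w * S w)) :
    ∑ᶠ w, c w * S w - τ (∑ᶠ w, c w * S w) = D * ∑ᶠ w, c' w * S w := by
  have fin : ∀ {b f : I → B}, (Function.support b).Finite → (∀ w, b w = 0 → f w = 0) →
      (Function.support f).Finite := fun hb hbf => hb.subset fun w hw hbw => hw (hbf w hbw)
  have f1 : (Function.support fun w => c w * S w).Finite := fin hc fun w hw => by
    rw [hw, zero_mul]
  have f2 : (Function.support fun w => τ (c w * S w)).Finite := fin hc fun w hw => by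
    rw [hw, zero_mul, map_zero]
  have f3 : (Function.support fun w => (c w - τ (c w)) * S w).Finite := fin hc fun w hw => by
    rw [hw, map_zero, sub_zero, zero_mul]
  have f4 : (Function.support fun w => τ (c w) * (S w - τ (S w))).Finite := fin hc fun w hw => by
    rw [hw, map_zero, zero_mul]
  have f5 : (Function.support fun w => τ (c (e w)) * (S (e w) - τ (S (e w)))).Finite :=
    f4.preimage e.injective.injOn
  have f6 : (Function.support fun w => c' w * S w).Finite := fin hc' fun w hw => by
    rw [hw, zero_mul]
  have hτ : τ (∑ᶠ w, c w * S w) = ∑ᶠ w, τ (c w * S w) := τ.toAddMonoidHom.map_finsum f1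
  rw [hτ, ← finsum_sub_distrib f1 f2, mul_finsum' _ _ f6, ← finsum_congr h,
    finsum_add_distrib f3 f5, finsum_comp_equiv e (f := fun w => τ (c w) * (S w - τ (S w))),
    ← finsum_add_distrib f3 f4]
  refine finsum_congr fun w => ?_
  rw [map_mul]
  ring

section Left

variable {k i a b : ℕ} {u : SInf}

/-- The recursion of the Pieri coefficients under left multiplication of `u` by `s_i`. -/
theorem stepCoeff_left (j : ℕ) (ha : u.1 a = i + 1) (hb : u.1 b = i) (hak : a < k) (hkb : k ≤ b)
    (w : SInf) : stepCoeff k j u w - swapY i (stepCoeff k j u w) +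
      (if (w⁻¹).1 i < (w⁻¹).1 (i + 1) then
        swapY i (stepCoeff k j u (simpleRefl i * w)) * (varY (i + 1) - varY i) else 0) =
      (varY (i + 1) - varY i) * stepCoeff k j (simpleRefl i * u) w := by
  have hiF : ∀ w', i ∉ fixedValues k u w' := fun w' hi => by
    obtain ⟨l, hl, -, h2⟩ := mem_fixedValues.1 hi
    have := u.1.injective (h2.trans hb.symm)
    omega
  by_cases hw : w.1 a = i + 1
  · have h0 : stepCoeff k j u (simpleRefl i * w) = 0 := if_neg (not_kStep_of_apply_eq ha hak hw)
    rw [h0, map_zero, zero_mul, ite_self, add_zero]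
    unfold stepCoeff
    by_cases hK : KStep k u w
    · rw [if_pos hK, if_pos ((kStep_left_iff_of_eq ha hb hak hkb hw).2 hK)]
      unfold stepWeight
      have hmem : i + 1 ∈ fixedValues k u w := mem_fixedValues.2 ⟨a, hak, by rw [ha, hw], ha⟩
      have hF : fixedValues k (simpleRefl i * u) w = (fixedValues k u w).erase (i + 1) := by
        ext q
        rw [Finset.mem_erase, mem_fixedValues, mem_fixedValues]
        have hne : ∀ l < k, u.1 l ≠ i := fun l hl h => by
          have := u.1.injective (h.trans hb.symm)
          omega
        constructor
        · rintro ⟨l, hl, h1, h2⟩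
          have hla : u.1 l ≠ i + 1 := by
            intro h
            obtain rfl := u.1.injective (h.trans ha.symm)
            rw [simpleRefl_mul_apply_left ha] at h1
            omega
          have e : (simpleRefl i * u).1 l = u.1 l := by
            rw [coe_mul_apply, coe_simpleRefl_apply, if_neg (hne l hl), if_neg hla]
          rw [e] at h1 h2
          exact ⟨by omega, l, hl, h1, h2⟩
        · rintro ⟨hq, l, hl, h1, h2⟩
          have e : (simpleRefl i * u).1 l = u.1 l := by
            rw [coe_mul_apply, coe_simpleRefl_apply, if_neg (hne l hl), if_neg (by omega)]
          exact ⟨l, hl, by rw [e, h1], by rw [e, h2]⟩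
      rw [hF, ← Finset.mul_prod_erase _ _ hmem, map_mul, swapY_prod, map_sub, swapY_varY,
        swapY_varZ, coe_simpleRefl_apply, if_neg (by omega), if_pos rfl,
        image_simpleRefl_of_notMem (fun h => hiF w (Finset.mem_of_mem_erase h))
          (Finset.notMem_erase _ _)]
      ring
    · rw [if_neg hK, if_neg (fun h => hK ((kStep_left_iff_of_eq ha hb hak hkb hw).1 h))]
      simp
  · have h0 : swapY i (stepCoeff k j u w) = stepCoeff k j u w := by
      unfold stepCoeff stepWeight
      split_ifs
      · rw [swapY_prod, image_simpleRefl_of_notMem (hiF w)]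
        intro hi
        obtain ⟨l, -, h1, h2⟩ := mem_fixedValues.1 hi
        obtain rfl := u.1.injective (h2.trans ha.symm)
        exact hw (h1.symm.trans h2)
      · exact map_zero _
    rw [h0, sub_self, zero_add]
    have hiff := kStep_left_iff_of_ne ha hb hak hkb hw
    unfold stepCoeff
    by_cases h1 : (w⁻¹).1 i < (w⁻¹).1 (i + 1)
    · rw [if_pos h1]
      by_cases hK : KStep k u (simpleRefl i * w)
      · rw [if_pos hK, if_pos (hiff.2 ⟨h1, hK⟩), stepWeight, stepWeight, swapY_prod,
          ← fixedValues_simpleRefl_mul, mul_comm]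
      · rw [if_neg hK, if_neg fun h => hK (hiff.1 h).2]
        simp
    · rw [if_neg h1, if_neg fun h => h1 (hiff.1 h).1, mul_zero]

/-- The Pieri formula for `u` implies that for `s_i u < u` when the values `i` and `i + 1` stand on
different sides of `k`: the variation under the exchange of `y_i` and `y_{i+1}`. -/
theorem PieriAt.simpleRefl_mul {j : ℕ} (h : PieriAt k j u) (ha : u.1 a = i + 1) (hb : u.1 b = i)
    (hak : a < k) (hkb : k ≤ b) : PieriAt k j (simpleRefl i * u) := by
  have hφ : ∀ q, swapY i (varY q) = varY ((simpleRefl i).1 q) := swapY_varY i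
  have hvar := schub_sub_map varY (swapY i) i hφ
  have e1 : (u⁻¹).1 (i + 1) = a := by rw [← ha, inv_apply_self']
  have e2 : (u⁻¹).1 i = b := by rw [← hb, inv_apply_self']
  have hu := hvar u
  rw [if_pos (by omega)] at hu
  have key : C (varY (i + 1) - varY i) * (elemProd k j * schub varY (simpleRefl i * u)) =
      C (varY (i + 1) - varY i) *
        ∑ᶠ w, C (stepCoeff k j (simpleRefl i * u) w) * schub varY w := by
    rw [← finsum_sub_map_finsum (map (swapY i)) (Equiv.mulLeft (simpleRefl i))
      (c := fun w => C (stepCoeff k j u w)) (S := schub varY)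
      (finite_support_of_stepCoeff k j u _ fun w hw => by rw [hw, C_0])
      (finite_support_of_stepCoeff k j _ _ fun w hw => by rw [hw, C_0]),
      ← h, map_mul, map_swapY_elemProd, ← mul_sub, hu, mul_left_comm]
    intro w
    simp only [Equiv.coe_mulLeft]
    rw [hvar, simpleRefl_mul_inv, mul_simpleRefl_apply_self,
      mul_simpleRefl_apply_succ, simpleRefl_mul_simpleRefl_mul, ← mul_assoc (C _) (C _), ← C_mul,
      ← stepCoeff_left j ha hb hak hkb w, map_C, map_C, ← C_sub, C_add]
    split_ifs
    · rw [C_mul, add_mul, mul_assoc (C _) (C _)]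
    · rw [mul_zero, C_0, add_zero, add_zero]
  refine mul_left_cancel₀ ?_ key
  rw [Ne, C_eq_zero, sub_eq_zero]
  intro he
  have := Sum.inl_injective (X_injective he)
  omega

end Left

/-- `w_0(n) t_{a_1, n+1} ⋯ t_{a_p, n+1}` (positions and values being counted from zero), where
`a_1 < ⋯ < a_p` are the elements of `A` below `k`. -/
def topPerm (n : ℕ) (A : Finset ℕ) : ℕ → SInf
  | 0 => w0 n
  | k + 1 => if k ∈ A then topPerm n A k * transp k (n + 1) else topPerm n A k

section Top

variable {n : ℕ} {A : Finset ℕ}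

theorem topPerm_succ_of_mem {k : ℕ} (h : k ∈ A) :
    topPerm n A (k + 1) = topPerm n A k * transp k (n + 1) := if_pos h

theorem topPerm_succ_of_notMem {k : ℕ} (h : k ∉ A) : topPerm n A (k + 1) = topPerm n A k :=
  if_neg h

theorem topPerm_congr {B : Finset ℕ} {k : ℕ} (h : ∀ x < k, x ∈ A ↔ x ∈ B) :
    topPerm n A k = topPerm n B k := by
  induction k with
  | zero => rfl
  | succ k ih =>
    have hk := h k (by omega)
    have := ih fun x hx => h x (by omega)
    by_cases hA : k ∈ A
    · rw [topPerm_succ_of_mem hA, topPerm_succ_of_mem (hk.1 hA), this]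
    · rw [topPerm_succ_of_notMem hA, topPerm_succ_of_notMem (fun hB => hA (hk.2 hB)), this]

theorem topPerm_eq_of_forall {m k : ℕ} (hmk : m ≤ k) (h : ∀ x ∈ A, x < m ∨ k ≤ x) :
    topPerm n A k = topPerm n A m := by
  induction k, hmk using Nat.le_induction with
  | base => rfl
  | succ k hk ih =>
    rw [topPerm_succ_of_notMem fun hA => by have := h k hA; omega]
    exact ih fun x hx => by have := h x hx; omega

theorem memS_topPerm {k : ℕ} (hk : k ≤ n) : MemS (n + 1) (topPerm n A k) := by
  induction k with
  | zero => exact (memS_w0 n).mono (by omega)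
  | succ k ih =>
    by_cases hA : k ∈ A
    · rw [topPerm_succ_of_mem hA]
      exact (ih (by omega)).mul (memS_transp (by omega) le_rfl)
    · rw [topPerm_succ_of_notMem hA]
      exact ih (by omega)

theorem topPerm_apply {k l : ℕ} (h1 : k ≤ l) (h2 : l ≤ n) : (topPerm n A k).1 l = n - l := by
  induction k with
  | zero => exact w0_apply_of_le h2
  | succ k ih =>
    by_cases hA : k ∈ A
    · rw [topPerm_succ_of_mem hA, mul_transp_apply, if_neg (by omega), if_neg (by omega)]
      exact ih (by omega)
    · rw [topPerm_succ_of_notMem hA]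
      exact ih (by omega)

theorem lt_topPerm_apply {k : ℕ} (hk : k ≤ n) : n - k < (topPerm n A k).1 (n + 1) := by
  induction k with
  | zero =>
    change n - 0 < (w0 n).1 (n + 1)
    rw [w0_apply_of_gt (by omega)]
    omega
  | succ k ih =>
    by_cases hA : k ∈ A
    · rw [topPerm_succ_of_mem hA, mul_transp_apply, if_neg (by omega), if_pos rfl,
        topPerm_apply le_rfl (by omega)]
      omega
    · rw [topPerm_succ_of_notMem hA]
      have := ih (by omega)
      omega

theorem kChain_topPerm {K k : ℕ} (hk : k ≤ K) (hK : K ≤ n) :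
    KChain K (w0 n) (A ∩ Finset.range k) (topPerm n A k) := by
  induction k with
  | zero =>
    rw [Finset.range_zero, Finset.inter_empty]
    exact KChain.refl
  | succ k ih =>
    rw [Finset.range_add_one]
    by_cases hA : k ∈ A
    · rw [topPerm_succ_of_mem hA, Finset.inter_insert_of_mem hA]
      refine (ih (by omega)).step (by simp) (by omega) (by omega) ⟨?_, fun c h1 h2 => ?_⟩
      · rw [topPerm_apply le_rfl (by omega)]
        exact lt_topPerm_apply (by omega)
      · rw [topPerm_apply le_rfl (by omega), topPerm_apply (by omega) (by omega)]
        omega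
    · rw [topPerm_succ_of_notMem hA, Finset.inter_insert_of_notMem hA]
      exact ih (by omega)

/-- After a position `a ∉ A` has been passed, either no element of `A` has followed, or a later one
obstructs the covers at `a`. -/
theorem topPerm_dichotomy {a k : ℕ} (ha : a ∉ A) (hak : a ≤ k) (hk : k ≤ n) :
    (∀ x ∈ A, x < a ∨ k ≤ x) ∨ ((topPerm n A k).1 (n + 1) < n - a ∧
      ∃ c, a < c ∧ c < k ∧ n - a < (topPerm n A k).1 c) := by
  induction k, hak using Nat.le_induction with
  | base => exact Or.inl fun x _ => by omega
  | succ k hak ih =>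
    have ih := ih (by omega)
    by_cases hA : k ∈ A
    · right
      have hne : a ≠ k := fun h => ha (h ▸ hA)
      rw [topPerm_succ_of_mem hA, mul_transp_apply, if_neg (by omega), if_pos rfl,
        topPerm_apply le_rfl (by omega)]
      refine ⟨by omega, ?_⟩
      rcases ih with h | ⟨-, c, h1, h2, h3⟩
      · refine ⟨k, by omega, by omega, ?_⟩
        rw [mul_transp_apply, if_pos rfl, topPerm_eq_of_forall hak h]
        exact lt_topPerm_apply (by omega)
      · refine ⟨c, h1, by omega, ?_⟩
        rwa [mul_transp_apply, if_neg (by omega), if_neg (by omega)]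
    · rw [topPerm_succ_of_notMem hA]
      rcases ih with h | ⟨h0, c, h1, h2, h3⟩
      · left
        intro x hx
        have := h x hx
        have : x ≠ k := fun h => hA (h ▸ hx)
        omega
      · exact Or.inr ⟨h0, c, h1, by omega, h3⟩

theorem KChain.eq_topPerm {k : ℕ} (hk : k ≤ n) {w : SInf} (h : KChain k (w0 n) A w) :
    w = topPerm n A k := by
  induction h with
  | refl => exact (topPerm_eq_of_forall (m := 0) (by omega) (by simp)).symm
  | @step A v a b h ha hak hkb hcov ih =>
    subst ih
    have hva : (topPerm n A k).1 a = n - a := by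
      rw [h.apply_of_notMem hak ha, w0_apply_of_le (by omega)]
    have hmem := memS_topPerm (A := A) hk
    have hb : n + 1 ≤ b := by
      by_contra hb
      have := hcov.1
      rw [hva, topPerm_apply hkb (by omega)] at this
      omega
    have hle : ∀ c ≤ n + 1, n + 1 < b → (topPerm n A k).1 c < (topPerm n A k).1 b :=
      fun c hc hb => by
        have := hmem.apply_le hc
        rw [hmem b hb]
        omega
    rcases topPerm_dichotomy ha hak.le hk with hd | ⟨hd, c, h1, h2, h3⟩
    · have hlt := lt_topPerm_apply (A := A) (show a ≤ n by omega)
      rw [← topPerm_eq_of_forall hak.le hd] at hlt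
      have hbn : b = n + 1 := by
        by_contra hne
        have := hle (n + 1) le_rfl (by omega)
        exact hcov.2 (n + 1) (by omega) (by omega) ⟨by omega, this⟩
      rw [topPerm_eq_of_forall (A := insert a A) (m := a + 1) (by omega), topPerm_succ_of_mem (by simp),
        topPerm_congr (B := A) (k := a), topPerm_eq_of_forall hak.le hd, hbn]
      · intro x hx
        rw [Finset.mem_insert]
        exact or_iff_right (by omega)
      · intro x hx
        rcases Finset.mem_insert.1 hx with rfl | hx
        · omega
        · have := hd x hx
          omega
    · exfalso
      rcases Nat.eq_or_lt_of_le hb with rfl | hb'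
      · have := hcov.1
        omega
      · exact hcov.2 c h1 (by omega) ⟨by omega, hle c (by omega) hb'⟩

theorem code_topPerm {k : ℕ} (hk : k ≤ n) (i : ℕ) : code (topPerm n A k) i =
    n - i + if i < k ∧ i ∈ A then 1 else 0 := by
  induction k with
  | zero =>
    rw [if_neg (by omega)]
    exact code_w0 n i
  | succ k ih =>
    have ih := ih (by omega)
    by_cases hA : k ∈ A
    · have hm := memS_topPerm (A := A) hk
      have hmk := (memS_topPerm (n := n) (A := A) (k := k) (by omega)).apply_le (i := n + 1) le_rfl
      have hlt := lt_topPerm_apply (n := n) (A := A) (k := k) (by omega)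
      rcases lt_or_ge i k with hik | hik
      · rw [topPerm_succ_of_mem hA, code_mul_transp_of_lt _ hik (by omega), ih]
        congr 1
        exact if_congr (and_congr_left fun _ => by omega) rfl rfl
      rcases lt_or_ge n i with hin | hin
      · rw [if_neg (by omega), code_eq_zero_of_memS hm (by omega)]
        omega
      have hval : ∀ l, i < l → (topPerm n A (k + 1)).1 l =
          if l ≤ n then n - l else if l = n + 1 then n - k else l := by
        intro l hl
        split_ifs with h1 h2
        · exact topPerm_apply (by omega) h1
        · rw [h2, topPerm_succ_of_mem hA, mul_transp_apply, if_neg (by omega), if_pos rfl,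
            topPerm_apply le_rfl (by omega)]
        · exact hm l (by omega)
      have hset : {j | i < j ∧ (topPerm n A (k + 1)).1 j < (topPerm n A (k + 1)).1 i} =
          (Finset.Ioc i (if i = k then n + 1 else n) : Finset ℕ) := by
        ext l
        simp only [Set.mem_ofPred_eq, Finset.coe_Ioc, Set.mem_Ioc]
        refine and_congr_right fun hl => ?_
        rw [hval l hl]
        rcases eq_or_ne i k with rfl | hne
        · rw [topPerm_succ_of_mem hA, mul_transp_apply, if_pos rfl, if_pos rfl]
          split_ifs <;> omega
        · rw [topPerm_apply (by omega) hin, if_neg hne]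
          split_ifs <;> omega
      unfold code
      rw [hset, Set.ncard_coe_finset, Nat.card_Ioc]
      rcases eq_or_ne i k with rfl | hne
      · rw [if_pos rfl, if_pos ⟨by omega, hA⟩]
        omega
      · rw [if_neg hne, if_neg (by omega), add_zero]
    · rw [topPerm_succ_of_notMem hA, ih]
      congr 1
      refine if_congr (and_congr_left fun hi => ?_) rfl rfl
      have : i ≠ k := fun h => hA (h ▸ hi)
      omega

theorem schub_topPerm {R : Type*} [CommRing R] [IsDomain R] (a : ℕ → R) {k : ℕ} (hk : k ≤ n)
    (hn : 0 < n) (hA : A ⊆ Finset.range k) : schub a (topPerm n A k) =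
      (∏ i ∈ A, (X i - C (a (n - i)))) * schub a (w0 n) := by
  have hd : IsDominant (topPerm n A k) := fun i => by
    rw [code_topPerm hk, code_topPerm hk]
    split_ifs <;> omega
  rw [schub_of_isDominant a (by omega) _ (memS_topPerm hk) hd, schub_eq a hn (memS_w0 n),
    inv_mul_cancel, ddiffPerm_one, schubTop_eq,
    ← diagramProd_mono (show n ≤ n + 1 + 1 by omega) fun i hi => by omega]
  unfold diagramProd
  have hA' : A = (Finset.range (n + 1 + 1)).filter (· ∈ A) := by
    ext x
    rw [Finset.mem_filter, Finset.mem_range]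
    refine ⟨fun hx => ⟨?_, hx⟩, fun hx => hx.2⟩
    have := Finset.mem_range.1 (hA hx)
    omega
  conv_rhs => rw [hA', Finset.prod_filter]
  rw [← Finset.prod_mul_distrib]
  refine Finset.prod_congr rfl fun i _ => ?_
  rw [code_topPerm hk]
  by_cases hi : i ∈ A
  · rw [if_pos hi, if_pos ⟨Finset.mem_range.1 (hA hi), hi⟩, Finset.prod_range_succ, mul_comm]
  · rw [if_neg hi, if_neg fun h => hi h.2, add_zero, one_mul]

end Top

/-- The Pieri formula for the longest element, by expanding
`x_i - z_j = (x_i - y_{n+2-i}) + (y_{n+2-i} - z_j)`. -/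
theorem pieriAt_w0 (j : ℕ) {k n : ℕ} (hn : 0 < n) (hk : k ≤ n) : PieriAt k j (w0 n) := by
  classical
  have hchain : ∀ A ∈ (Finset.range k).powerset, KChain k (w0 n) A (topPerm n A k) := fun A hA => by
    have := kChain_topPerm (A := A) (le_refl k) hk
    rwa [Finset.inter_eq_left.2 (Finset.mem_powerset.1 hA)] at this
  have hinj : Set.InjOn (fun A => topPerm n A k) ((Finset.range k).powerset : Set (Finset ℕ)) := by
    intro A hA B hB hAB
    have h1 := hchain A hA
    have h2 := hchain B hB
    simp only at hAB
    rw [← hAB] at h2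
    ext c
    by_cases hc : c < k
    · rw [h1.mem_iff hc, h2.mem_iff hc]
    · exact iff_of_false (fun h => hc (Finset.mem_range.1 (h1.subset h)))
        (fun h => hc (Finset.mem_range.1 (h2.subset h)))
  have hcoeff : ∀ A ∈ (Finset.range k).powerset, stepCoeff k j (w0 n) (topPerm n A k) =
      ∏ i ∈ Finset.range k \ A, (varY (n - i) - varZ j) := by
    intro A hA
    have h1 := hchain A hA
    have hF : fixedValues k (w0 n) (topPerm n A k) = (Finset.range k \ A).image (w0 n).1 := by
      ext q
      simp only [mem_fixedValues, Finset.mem_image, Finset.mem_sdiff, Finset.mem_range]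
      refine exists_congr fun l => ?_
      constructor
      · rintro ⟨h2, h3, h4⟩
        exact ⟨⟨h2, fun h => (h1.mem_iff h2).1 h h3⟩, h4⟩
      · rintro ⟨⟨h2, h3⟩, h4⟩
        exact ⟨h2, not_not.1 fun h => h3 ((h1.mem_iff h2).2 h), h4⟩
    rw [stepCoeff, if_pos (kStep_iff.2 ⟨A, h1⟩), stepWeight, hF,
      Finset.prod_image fun x _ y _ h => (w0 n).1.injective h]
    refine Finset.prod_congr rfl fun i hi => ?_
    have := Finset.mem_range.1 (Finset.mem_sdiff.1 hi).1
    rw [w0_apply_of_le (by omega)]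
  unfold PieriAt
  rw [finsum_eq_sum_of_support_subset (s := (Finset.range k).powerset.image fun A => topPerm n A k),
    Finset.sum_image hinj]
  · have hsplit : elemProd k j = ∏ i ∈ Finset.range k,
        ((X i - C (varY (n - i))) + C (varY (n - i) - varZ j)) :=
      Finset.prod_congr rfl fun i _ => by rw [C_sub]; ring
    rw [hsplit, Finset.prod_add, Finset.sum_mul]
    refine Finset.sum_congr rfl fun A hA => ?_
    rw [hcoeff A hA, schub_topPerm varY hk hn (Finset.mem_powerset.1 hA), map_prod]
    ring
  · intro w hw
    have hK : KStep k (w0 n) w := by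
      by_contra hc
      refine hw ?_
      simp only [stepCoeff, if_neg hc, C_0, zero_mul]
    obtain ⟨A, hA⟩ := kStep_iff.1 hK
    rw [Finset.coe_image]
    exact ⟨A, Finset.mem_coe.2 (Finset.mem_powerset.2 hA.subset), (hA.eq_topPerm hk).symm⟩

/-- The Pieri formula, by descent from the longest element `w_0(n)`. -/
theorem pieriAt (k j : ℕ) (u : SInf) : PieriAt k j u := by
  obtain ⟨n, hkn, hu⟩ := exists_memS_ge u k
  induction hm : (n + 1) * (n + 1) - len u using Nat.strong_induction_on generalizing u with
  | _ m ih =>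
    by_cases h1 : ∃ i < n, i + 1 ≠ k ∧ u.1 i < u.1 (i + 1)
    · obtain ⟨i, hin, hik, hlt⟩ := h1
      have hu' : MemS n (u * simpleRefl i) := hu.mul (memS_simpleRefl (by omega))
      have hl := len_mul_simpleRefl_of_lt hlt
      have hb := len_le_of_memS hu'
      have := (ih _ (by omega) _ hu' rfl).mul_simpleRefl hik (by
        rwa [mul_simpleRefl_apply_self, mul_simpleRefl_apply_succ])
      rwa [mul_simpleRefl_mul_simpleRefl] at this
    push Not at h1
    by_cases h2 : 0 < k ∧ u.1 (k - 1) < u.1 k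
    · -- two consecutive values in the wrong order on the two sides of `k`
      obtain ⟨i, hi1, hi2, hi3⟩ : ∃ i, i < u.1 k ∧ (u⁻¹).1 i < k ∧ k ≤ (u⁻¹).1 (i + 1) := by
        by_contra hc
        push Not at hc
        have : ∀ x, u.1 (k - 1) ≤ x → x ≤ u.1 k → (u⁻¹).1 x < k := by
          intro x hx
          induction x, hx using Nat.le_induction with
          | base => exact fun _ => by rw [inv_apply_self']; omega
          | succ x _ ihx => exact fun hx => hc x (by omega) (ihx (by omega))
        have := this _ h2.2.le le_rfl
        rw [inv_apply_self'] at this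
        omega
      have hin : i + 1 ≤ n := by
        have := hu.apply_le (i := k) hkn.le
        omega
      have hu' : MemS n (simpleRefl i * u) := (memS_simpleRefl hin).mul hu
      have hl := len_simpleRefl_mul_of_lt (u := u) (i := i) (by omega)
      have hb := len_le_of_memS hu'
      have := (ih _ (by omega) _ hu' rfl).simpleRefl_mul (i := i) (a := (u⁻¹).1 i)
        (b := (u⁻¹).1 (i + 1)) (simpleRefl_mul_apply_right (apply_inv_self' u i))
        (simpleRefl_mul_apply_left (apply_inv_self' u (i + 1))) hi2 hi3
      rwa [simpleRefl_mul_simpleRefl_mul] at this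
    · obtain rfl := eq_w0_of_forall_gt hu fun i hi => by
        have hne := apply_ne_apply_succ u i
        by_cases hik : i + 1 = k
        · subst hik
          rw [Nat.add_sub_cancel] at h2
          omega
        · have := h1 i hi hik
          omega
      exact pieriAt_w0 j (by omega) hkn.le

/-! ### Iterating the Pieri formula -/

/-- The sequences `u = u_0 →_{λ_1} u_1 →_{λ_2} ⋯ →_{λ_m} u_m` with arbitrary end. -/
def pathsFrom (lm : List ℕ) (u : SInf) : Set (Fin (lm.length + 1) → SInf) :=
  {P | P 0 = u ∧ ∀ i : Fin lm.length, KStep (lm.get i) (P i.castSucc) (P i.succ)}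

/-- The weight of a path with the indices of the variables `z_j` shifted by `o`. -/
noncomputable def shiftedWeight (o : ℕ) (lm : List ℕ) (P : Fin (lm.length + 1) → SInf) :
    CoeffRing :=
  ∏ i : Fin lm.length, stepWeight (lm.get i) (P i.castSucc) (P i.succ) (o + i)

theorem pathsFrom_nil (u : SInf) : pathsFrom [] u = {fun _ => u} := by
  ext P
  simp only [pathsFrom, Set.mem_ofPred_eq, Set.mem_singleton_iff]
  constructor
  · rintro ⟨h, -⟩
    funext i
    rw [← h]
    congr 1
    exact Subsingleton.elim (α := Fin 1) _ _
  · rintro rfl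
    exact ⟨rfl, fun i => i.elim0⟩

theorem pathsFrom_cons (k : ℕ) (t : List ℕ) (u : SInf) : pathsFrom (k :: t) u =
    ⋃ u' ∈ {u' | KStep k u u'}, (fun P => (Fin.cons u P : Fin (t.length + 1 + 1) → SInf)) ''
      pathsFrom t u' := by
  ext P
  simp only [Set.mem_iUnion, Set.mem_image, exists_prop]
  constructor
  · rintro ⟨h1, h2⟩
    refine ⟨P (Fin.succ 0), ?_, Fin.tail P, ⟨rfl, fun i => h2 i.succ⟩, ?_⟩
    · have := h2 0
      rw [Fin.castSucc_zero, h1] at this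
      exact this
    · rw [← h1]
      exact Fin.cons_self_tail P
  · rintro ⟨u', h, Q, ⟨rfl, h2⟩, rfl⟩
    refine ⟨rfl, fun i => ?_⟩
    refine Fin.cases ?_ (fun i => ?_) i
    · exact h
    · exact h2 i

theorem finite_pathsFrom (lm : List ℕ) (u : SInf) : (pathsFrom lm u).Finite := by
  induction lm generalizing u with
  | nil =>
    rw [pathsFrom_nil]
    exact Set.finite_singleton _
  | cons k t ih =>
    rw [pathsFrom_cons]
    exact (finite_kStep k u).biUnion fun u' _ => (ih u').image _

theorem pathSet_subset (lm : List ℕ) (u w : SInf) : PathSet lm u w ⊆ pathsFrom lm u :=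
  fun _ hP => ⟨hP.1, hP.2.2⟩

theorem pieri_stepWeight (k j : ℕ) (u : SInf) : elemProd k j * schub varY u =
    ∑ᶠ w ∈ {w | KStep k u w}, C (stepWeight k u w j) * schub varY w := by
  rw [pieriAt k j u]
  refine finsum_congr fun w => ?_
  unfold stepCoeff
  by_cases h : KStep k u w <;> simp [h]

theorem pieri_pathsFrom (lm : List ℕ) (o : ℕ) (u : SInf) :
    (∏ i : Fin lm.length, elemProd (lm.get i) (o + i)) * schub varY u =
      ∑ᶠ P ∈ pathsFrom lm u, C (shiftedWeight o lm P) * schub varY (P (Fin.last _)) := by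
  induction lm generalizing o u with
  | nil =>
    rw [pathsFrom_nil, finsum_mem_singleton]
    simp [shiftedWeight]
  | cons k t ih =>
    have hinj : Function.Injective
        fun P => (Fin.cons u P : Fin (t.length + 1 + 1) → SInf) :=
      Fin.cons_right_injective (α := fun _ => SInf) u
    have hdisj : {u' | KStep k u u'}.PairwiseDisjoint fun u' =>
        (fun P => (Fin.cons u P : Fin (t.length + 1 + 1) → SInf)) '' pathsFrom t u' := by
      intro u₁ _ u₂ _ hne
      rw [Function.onFun, Set.disjoint_left]
      rintro _ ⟨P, hP, rfl⟩ ⟨Q, hQ, he⟩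
      have : Q = P := hinj he
      subst this
      exact hne (hP.1.symm.trans hQ.1)
    have hsum := finsum_mem_biUnion (f := fun P : Fin (t.length + 1 + 1) → SInf =>
      C (shiftedWeight o (k :: t) P) * schub varY (P (Fin.last _))) hdisj (finite_kStep k u)
      fun u' _ => (finite_pathsFrom t u').image _
    rw [pathsFrom_cons]
    refine Eq.trans ?_ hsum.symm
    have hprod : (∏ i : Fin (k :: t).length, elemProd ((k :: t).get i) (o + i)) =
        (∏ i : Fin t.length, elemProd (t.get i) (o + 1 + i)) * elemProd k o := by
      refine (Fin.prod_univ_succ (n := t.length) _).trans ?_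
      rw [mul_comm]
      refine congrArg₂ _ (Finset.prod_congr rfl fun i _ => ?_) rfl
      rw [Fin.val_succ, add_assoc, add_comm 1]
      rfl
    rw [hprod, mul_assoc, pieri_stepWeight, mul_finsum_mem' _ _ (finite_kStep k u)]
    refine finsum_mem_congr rfl fun u' _ => ?_
    rw [mul_left_comm, ih, finsum_mem_image hinj.injOn,
      mul_finsum_mem' _ _ (finite_pathsFrom t u')]
    refine finsum_mem_congr rfl fun P hP => ?_
    have hw : shiftedWeight o (k :: t) (Fin.cons u P : Fin (t.length + 1 + 1) → SInf) =
        stepWeight k u u' o * shiftedWeight (o + 1) t P := by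
      refine (Fin.prod_univ_succ (n := t.length) _).trans ?_
      refine congrArg₂ _ ?_ (Finset.prod_congr rfl fun i _ => ?_)
      · change stepWeight k u (P 0) (o + 0) = _
        rw [hP.1, add_zero]
      · rw [Fin.val_succ, add_assoc o 1, add_comm 1]
        rfl
    rw [hw, C_mul, mul_assoc]
    rfl

theorem finite_support_dCoeff (lm : List ℕ) (u : SInf) :
    (Function.support fun w => dCoeff u lm w).Finite := by
  refine ((finite_pathsFrom lm u).image fun P => P (Fin.last _)).subset fun w hw => ?_
  by_contra hc
  have he : PathSet lm u w = ∅ := Set.eq_empty_of_forall_notMem fun P hP =>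
    hc ⟨P, pathSet_subset lm u w hP, hP.2.1⟩
  refine hw ?_
  simp only [dCoeff, he, finsum_mem_empty]

theorem pieri_dCoeff (lm : List ℕ) (u : SInf) :
    (∏ i : Fin lm.length, elemProd (lm.get i) i) * schub varY u =
      ∑ᶠ w : SInf, C (dCoeff u lm w) * schub varY w := by
  have h := pieri_pathsFrom lm 0 u
  simp only [zero_add] at h
  set W := (fun P : Fin (lm.length + 1) → SInf => P (Fin.last _)) '' pathsFrom lm u with hW
  have hU : pathsFrom lm u = ⋃ w ∈ W, PathSet lm u w := by
    ext P
    simp only [Set.mem_iUnion, exists_prop]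
    constructor
    · intro hP
      exact ⟨_, ⟨P, hP, rfl⟩, hP.1, rfl, hP.2⟩
    · rintro ⟨w, -, hP⟩
      exact pathSet_subset lm u w hP
  have hdisj : W.PairwiseDisjoint (PathSet lm u) := by
    intro w₁ _ w₂ _ hne
    rw [Function.onFun, Set.disjoint_left]
    intro P h1 h2
    exact hne (h1.2.1.symm.trans h2.2.1)
  rw [h, hU, finsum_mem_biUnion hdisj ((finite_pathsFrom lm u).image _)
    fun w _ => (finite_pathsFrom lm u).subset (pathSet_subset lm u w)]
  refine finsum_congr fun w => ?_
  have hfin := (finite_pathsFrom lm u).subset (pathSet_subset lm u w)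
  have hin : ∑ᶠ P ∈ PathSet lm u w, C (shiftedWeight 0 lm P) * schub varY (P (Fin.last _)) =
      C (dCoeff u lm w) * schub varY w := by
    have hC : C (dCoeff u lm w) = ∑ᶠ P ∈ PathSet lm u w, (C (pathWeight lm P) : MvPolynomial ℕ _) :=
      AddMonoidHom.map_finsum_mem _ (C : CoeffRing →+* MvPolynomial ℕ CoeffRing).toAddMonoidHom hfin
    rw [hC, finsum_mem_mul' _ _ hfin]
    refine finsum_mem_congr rfl fun P hP => ?_
    rw [hP.2.1]
    simp only [shiftedWeight, pathWeight, zero_add]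
  rw [hin]
  by_cases hw : w ∈ W
  · simp [hw]
  · have he : PathSet lm u w = ∅ := Set.eq_empty_of_forall_notMem fun P hP =>
      hw ⟨P, pathSet_subset lm u w hP, hP.2.1⟩
    simp [hw, dCoeff, he]

/-! ### The dominant approximation -/

theorem mem_iff_lt_ncard {S : Set ℕ} (hf : S.Finite) (hl : IsLowerSet S) (j : ℕ) :
    j ∈ S ↔ j < S.ncard := by
  classical
  have hex : ∃ k, k ∉ S := hf.exists_notMem
  have hS : S = (Finset.range (Nat.find hex) : Finset ℕ) := by
    ext i
    rw [Finset.coe_range, Set.mem_Iio]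
    constructor
    · intro hi
      by_contra hc
      exact Nat.find_spec hex (hl (not_lt.1 hc) hi)
    · intro hi
      exact not_not.1 (Nat.find_min hex hi)
  conv_lhs => rw [hS]
  conv_rhs => rw [hS]
  rw [Set.ncard_coe_finset, Finset.card_range, Finset.coe_range, Set.mem_Iio]

theorem finite_lt_code (v : SInf) (i : ℕ) : {j | i < code v j}.Finite := by
  obtain ⟨n, -, hv⟩ := exists_memS v
  refine (Set.finite_Iio n).subset fun j hj => ?_
  by_contra hc
  have := code_eq_zero_of_memS hv (not_lt.1 hc)
  simp only [Set.mem_ofPred_eq] at hj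
  omega

theorem lt_lamPart_iff (v : SInf) (i j : ℕ) : j < lamPart v i ↔ i < code (domApprox v) j := by
  have hanti : Antitone (code (domApprox v)) := antitone_nat_of_succ_le (domApprox_isDominant v)
  exact (mem_iff_lt_ncard (finite_lt_code _ i) (fun a b hba ha => lt_of_lt_of_le ha (hanti hba)) j).symm

theorem lt_length_lam_iff (v : SInf) (i : ℕ) : i < (lam v).length ↔ lamPart v i ≠ 0 := by
  have hpos : ∀ i, lamPart v i ≠ 0 ↔ i < code (domApprox v) 0 := fun i => by
    rw [← lt_lamPart_iff, Nat.pos_iff_ne_zero]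
  rw [lam, List.length_map, List.length_range]
  refine (mem_iff_lt_ncard ?_ ?_ i).symm
  · simp only [hpos]
    exact Set.finite_Iio _
  · intro a b hba ha
    simp only [hpos, Set.mem_ofPred_eq] at ha ⊢
    omega

theorem lam_get (v : SInf) (i : Fin (lam v).length) : (lam v).get i = lamPart v i := by
  have : ∀ (m : ℕ) (f : ℕ → ℕ) (L : List ℕ), L = (List.range m).map f →
      ∀ i : Fin L.length, L.get i = f i := by
    rintro m f _ rfl i
    simp
  exact this _ _ _ rfl i

theorem schub_domApprox (v : SInf) : schub varZ (domApprox v) =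
    ∏ i : Fin (lam v).length, elemProd ((lam v).get i) i := by
  obtain ⟨n, hn, hv⟩ := exists_memS (domApprox v)
  have h1 : (∏ i : Fin (lam v).length, elemProd ((lam v).get i) i) =
      ∏ i ∈ Finset.range (lam v).length, elemProd (lamPart v i) i := by
    rw [← Fin.prod_univ_eq_prod_range (fun i => elemProd (lamPart v i) i)]
    refine Finset.prod_congr rfl fun i _ => ?_
    rw [lam_get]
  rw [h1, schub_of_isDominant varZ hn _ hv (domApprox_isDominant v)]
  unfold diagramProd elemProd
  refine Finset.prod_comm' fun i j => ?_
  simp only [Finset.mem_range, lt_length_lam_iff, lt_lamPart_iff, ← Nat.pos_iff_ne_zero]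
  have hanti : Antitone (code (domApprox v)) := antitone_nat_of_succ_le (domApprox_isDominant v)
  have h2 := hanti (Nat.zero_le i)
  have h3 := code_le_of_memS hv i
  omega

theorem code_eq_zero_of_ascents {p : ℕ} {x : SInf} (h : ∀ i > p, x.1 i < x.1 (i + 1)) {j : ℕ}
    (hj : p < j) : code x j = 0 := by
  have hlt : ∀ l, j + 1 ≤ l → x.1 j < x.1 l := by
    intro l hl
    induction l, hl using Nat.le_induction with
    | base => exact h j hj
    | succ l hl ih => exact ih.trans (h l (by omega))
  have : {l | j < l ∧ x.1 l < x.1 j} = ∅ := Set.eq_empty_of_forall_notMem fun l hl => by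
    have := hlt l hl.1
    have := hl.2
    omega
  unfold code
  rw [this, Set.ncard_empty]

/-- The dominant approximation is reached by a sequence of ascents `s_i`, and these stay to the
left of any position from which `v` is increasing. -/
theorem exists_word_iterate_domStep (v : SInf) (k : ℕ) : ∃ ω : List ℕ,
    domStep^[k] v = v * wordProd ω ∧ len (domStep^[k] v) = len v + ω.length ∧
    ∀ p, (∀ i > p, v.1 i < v.1 (i + 1)) →
      (∀ i ∈ ω, i < p) ∧ ∀ j > p, (domStep^[k] v).1 j = v.1 j := by
  induction k with
  | zero => exact ⟨[], by simp [wordProd_nil], by simp, fun p _ => by simp⟩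
  | succ k ih =>
    obtain ⟨ω, h1, h2, h3⟩ := ih
    rw [Function.iterate_succ_apply']
    set x := domStep^[k] v with hx
    by_cases hd : IsDominant x
    · rw [domStep_of_isDominant hd]
      exact ⟨ω, h1, h2, h3⟩
    · obtain ⟨i, hi⟩ := exists_isLastAscent hd
      rw [domStep_of_isLastAscent hi]
      have hlt : code x i < code x (i + 1) := hi.1
      refine ⟨ω ++ [i], ?_, ?_, fun p hp => ?_⟩
      · rw [wordProd_append, wordProd_cons, wordProd_nil, mul_one, ← mul_assoc, ← h1]
      · rw [len_mul_simpleRefl_of_lt (lt_of_code_lt x i hlt), h2, List.length_append]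
        rfl
      · obtain ⟨h4, h5⟩ := h3 p hp
        have hip : i < p := by
          by_contra hc
          have := code_eq_zero_of_ascents (x := x) (p := p)
            (fun l hl => by rw [h5 l hl, h5 (l + 1) (by omega)]; exact hp l hl)
            (j := i + 1) (by omega)
          omega
        refine ⟨fun l hl => ?_, fun j hj => ?_⟩
        · rw [List.mem_append, List.mem_singleton] at hl
          rcases hl with hl | rfl
          · exact h4 l hl
          · exact hip
        · rw [mul_simpleRefl_apply_of_ne x (by omega) (by omega), h5 j hj]

theorem exists_word_domApprox (v : SInf) : ∃ ω : List ℕ,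
    v⁻¹ * domApprox v = wordProd ω ∧ len (domApprox v) = len v + len (v⁻¹ * domApprox v) ∧
    ∀ p, (∀ i > p, v.1 i < v.1 (i + 1)) → ∀ i ∈ ω, i < p := by
  obtain ⟨k, hk⟩ := exists_isDominant v
  obtain ⟨ω, h1, h2, h3⟩ := exists_word_iterate_domStep v k
  rw [domStep_iterate_eq k hk] at h1 h2
  have e : v⁻¹ * domApprox v = wordProd ω := by rw [h1, inv_mul_cancel_left]
  refine ⟨ω, e, ?_, fun p hp => (h3 p hp).1⟩
  have l1 := len_wordProd_le ω
  have l2 := len_mul_le v (wordProd ω)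
  rw [← h1] at l2
  rw [e]
  omega

/-! ### Ascent words -/

/-- `∂^g` is linear over `𝔖_u` if `g` has a word in ascents of `u`.  Such a `g` preserves
`{0, …, i}` for every descent `i` of `u`, so that the descents of `g` are ascents of `u`. -/
theorem ddiffPerm_schub_mul {R : Type*} [CommRing R] [IsDomain R] (a : ℕ → R) {u : SInf} (g : SInf)
    (hg : ∀ i, u.1 (i + 1) < u.1 i → ∀ j, g.1 j ≤ i ↔ j ≤ i) (P : MvPolynomial ℕ R) :
    ddiffPerm g (schub a u * P) = schub a u * ddiffPerm g P := by
  induction h : len g generalizing g P with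
  | zero =>
    obtain rfl : g = 1 := by
      by_contra hne
      obtain ⟨i, hi⟩ := exists_descent hne
      have := len_mul_simpleRefl_of_gt hi
      omega
    rw [ddiffPerm_one, ddiffPerm_one]
  | succ n ih =>
    have hne : g ≠ 1 := by
      rintro rfl
      rw [len_one] at h
      omega
    obtain ⟨i, hi⟩ := exists_descent hne
    have hu : u.1 i < u.1 (i + 1) := by
      by_contra hc
      have hd := hg i (lt_of_le_of_ne (not_lt.1 hc) (apply_ne_apply_succ u i).symm)
      have h1 := (hd i).2 le_rfl
      have h2 := (hd (i + 1)).1 (by omega)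
      omega
    have hact : act (simpleRefl i) (schub a u) = schub a u :=
      act_eq_of_ddiff_eq_zero (ddiff_schub_of_lt a hu)
    have hl := len_mul_simpleRefl_of_gt hi
    have hlt : (g * simpleRefl i).1 i < (g * simpleRefl i).1 (i + 1) := by
      rwa [mul_simpleRefl_apply_self, mul_simpleRefl_apply_succ]
    have hsplit : ∀ Q : MvPolynomial ℕ R,
        ddiffPerm g Q = ddiffPerm (g * simpleRefl i) (ddiff i Q) := fun Q => by
      rw [← ddiffPerm_mul_simpleRefl hlt, mul_simpleRefl_mul_simpleRefl]
    rw [hsplit, hsplit, ddiff_mul_of_act_eq hact]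
    refine ih _ (fun l hl' j => ?_) _ (by omega)
    have hli : l ≠ i := by
      rintro rfl
      omega
    rw [coe_mul_apply, hg l hl', coe_simpleRefl_apply]
    split_ifs <;> omega

theorem HasAscentWord.apply_le_iff {u g : SInf} (h : HasAscentWord u g) {i : ℕ}
    (hi : u.1 (i + 1) < u.1 i) (j : ℕ) : g.1 j ≤ i ↔ j ≤ i := by
  obtain ⟨ω, rfl, hω⟩ := h
  induction ω with
  | nil => rfl
  | cons l ω ih =>
    have hl := (len_lt_len_mul_simpleRefl_iff u l).1 (hω l (by simp))
    have hli : l ≠ i := by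
      rintro rfl
      omega
    rw [wordProd_cons, coe_mul_apply, ← ih fun m hm => hω m (by simp [hm]), coe_simpleRefl_apply]
    split_ifs <;> omega

/-- The divided difference along a permutation as an additive homomorphism. -/
noncomputable def ddiffPermHom (g : SInf) :
    MvPolynomial ℕ CoeffRing →+ MvPolynomial ℕ CoeffRing :=
  AddMonoidHom.mk' (ddiffPerm g) (ddiffPerm_add g)

theorem schub_mul_schub {u v : SInf} (h : HasAscentWord u (v⁻¹ * domApprox v)) :
    schub varY u * schub varZ v = ∑ᶠ w : SInf, C (eCoeff u v w) * schub varY w := by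
  set g := v⁻¹ * domApprox v with hg
  obtain ⟨-, -, hlen, -⟩ := exists_word_domApprox v
  have hv : schub varZ v = ddiffPerm g (schub varZ (domApprox v)) := by
    have e : domApprox v * g⁻¹ = v := by
      rw [hg, mul_inv_rev, inv_inv, mul_inv_cancel_left]
    rw [ddiffPerm_schub, e, if_pos hlen.symm]
  have hp := congrArg (ddiffPermHom g) (pieri_dCoeff (lam v) u)
  rw [AddMonoidHom.map_finsum _ ((finite_support_dCoeff (lam v) u).subset fun w hw hc => hw (by
    simp only at hc
    rw [hc, C_0, zero_mul]))] at hp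
  change ddiffPerm g _ = ∑ᶠ w, ddiffPerm g _ at hp
  rw [← schub_domApprox, mul_comm, ddiffPerm_schub_mul _ _ fun i hi j => h.apply_le_iff hi j, ← hv,
    ← finsum_comp_equiv (Equiv.mulRight g)] at hp
  refine hp.trans (finsum_congr fun w => ?_)
  simp only [Equiv.coe_mulRight]
  rw [ddiffPerm_C_mul, ddiffPerm_schub, mul_inv_cancel_right, eCoeff, mul_assoc w, ← hg]
  by_cases hc : len (w * g) = len w + len g
  · rw [if_pos hc.symm, if_pos hc]
  · rw [if_neg (Ne.symm hc), if_neg hc, C_0, mul_zero, zero_mul]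

theorem finite_support_eCoeff (u v : SInf) : {w : SInf | eCoeff u v w ≠ 0}.Finite := by
  have hinj : Function.Injective fun w : SInf => w * v⁻¹ * domApprox v := fun a b hab =>
    mul_right_cancel (mul_right_cancel hab)
  refine ((finite_support_dCoeff (lam v) u).preimage hinj.injOn).subset fun w hw => ?_
  intro hc
  refine hw ?_
  simp only at hc
  rw [eCoeff, hc, ite_self]

end DoubleSchubert

open DoubleSchubert
theorem mainTheorem6 (u v : SInf) :
    (HasAscentWord u (v⁻¹ * domApprox v) →
      (∀ w : SInf, (PathSet (lam v) u w).Finite) ∧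
      {w : SInf | eCoeff u v w ≠ 0}.Finite ∧
      schub varY u * schub varZ v = ∑ᶠ w : SInf, MvPolynomial.C (eCoeff u v w) * schub varY w) ∧
    ((∃ p : ℕ, (∀ i < p, len u < len (u * simpleRefl i)) ∧ (∀ i > p, len v < len (v * simpleRefl i))) →
      HasAscentWord u (v⁻¹ * domApprox v)) ∧
    (IsDominant v → HasAscentWord u (v⁻¹ * domApprox v)) := by
  refine ⟨fun h => ⟨fun w => (finite_pathsFrom _ u).subset (pathSet_subset _ u w),
    finite_support_eCoeff u v, schub_mul_schub h⟩, ?_, fun hd => ⟨[], ?_, by simp⟩⟩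
  · rintro ⟨p, hu, hv⟩
    obtain ⟨ω, h1, -, h2⟩ := exists_word_domApprox v
    exact ⟨ω, h1, fun i hi => hu i (h2 p (fun l hl =>
      (len_lt_len_mul_simpleRefl_iff v l).1 (hv l hl)) i hi)⟩
  · rw [domApprox_of_isDominant hd, inv_mul_cancel, wordProd_nil]
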